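/- **Theorem.** Let $(S,\leq)$ be a finite graded poset with a unique minimal element $0$ and a unique maximal element $1$, let $\mathfrak b$ be a set of bonds on $S$, let $\mathbb K$ be a field and let $A$ be an LS algebra of flag type over $(S,\leq,\mathfrak b)$. Let $\mathcal C:\ 0=\sigma_0<\sigma_1<\cdots<\sigma_N=1$ be a maximal chain in $S$, and order $\mathbb Q^{\mathcal C}$ by the reverse lexicographic order: $v\prec v'$ if $v(\sigma_h)<v'(\sigma_h)$ for the largest $h$ with $v(\sigma_h)\neq v'(\sigma_h)$. Then there exists a positive valuation $\nu:A\setminus\{0\}\to\mathbb Q^{\mathcal C}$ such that $\nu(\sigma_h)=\sigma_h$ for all $h=0,\dots,N$ (where $\sigma_h$ also denotes the indicator function of $\{\sigma_h\}$ and the corresponding element of $A$). The notions are the following. *Bonds.* A set of bonds assigns a positive integer $\mathfrak b(\sigma,\tau)$ to each pair with $\tau$ covering $\sigma$, in such a way that the gcd of the bonds along a maximal chain from $\sigma$ to $\tau$ depends only on $\sigma$ and $\tau$; this gcd is denoted by $\mathfrak b(\sigma,\tau)$ too. *LS paths.* An LS path of degree $r\in\mathbb N$ is a function $\pi:S\to\mathbb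 Q_{\geq 0}$ with totally ordered support $\{\sigma_1<\dots<\sigma_n\}$ such that $\mathfrak b(\sigma_j,\sigma_{j+1})\sum_{i\leq j}\pi(\sigma_i)\in\mathbb N$ for $1\le j<n$ and $\sum_{i}\pi(\sigma_i)=r$. A monomial $\pi_1\cdots\pi_r$ of LS paths of degree $1$ is standard if, for some ordering of its factors, $\max\operatorname{supp}\pi_h\leq\min\operatorname{supp}\pi_{h+1}$ for all $h$. Every LS path $\pi$ can be written uniquely as $\pi=\pi_1+\cdots+\pi_r$ with $\pi_1\cdots\pi_r$ a standard monomial of LS paths of degree $1$, called its canonical form. On $\mathbb Q^S$ write $\pi\trianglelefteq\pi'$ if $\pi$ is at most $\pi'$ in the reverse lexicographic order of every total order on $S$ refining $\leq$. *LS algebras.* $A$ is a commutative $\mathbb K$-algebra with an injection of the LS paths of degree $1$ into $A$, extended to all LS paths by sending $\pi$ to the product $\pi_1\cdots\pi_r\in A$ given by its canonical form, such that: (LS1) the LS paths are a $\mathbb K$-basis of $A$, and their degree induces a grading of the algebra $A$; if a monomial $\pi_1\pi_2$ of degree $2$ is non-standard and $\pi_1\pi_2=\sum_jc_j\pi_{j,1}\pi_{j,2}$,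 $c_j\neq0$, is its expression in standard monomials (its straightening relation), then (LS2) $\pi_1+\pi_2\trianglelefteq\pi_{j,1}+\pi_{j,2}$ for all $j$, and (LS3) if $\operatorname{supp}\pi_1\cup\operatorname{supp}\pi_2$ is a chain then the canonical form of $\pi_1+\pi_2$ appears with coefficient $1$. *Flag type.* A system of weights is a map $\lambda$ from the LS paths to a free abelian group with $\lambda(\pi_1+\pi_2)=\lambda(\pi_1)+\lambda(\pi_2)$ whenever $\pi_1$, $\pi_2$ and $\pi_1+\pi_2$ are LS paths, for which the straightening relations are homogeneous. It is effective if, for all $\sigma\in S$ and $r\in\mathbb N$, $r\sigma$ is the only LS path of degree $r$ and weight $r\lambda(\sigma)$. The LS algebra $A$ is of flag type if it has an effective system of weights and, for every $\tau\in S$, the quotient $A_\tau=A/I_\tau$ is a domain, where $I_\tau$ is the ideal generated by the LS paths whose support is not contained in $\{\sigma\leq\tau\}$. *Valuations.* A valuation on $A$ with values in a totally ordered abelian group $V$ is a map $\nu:A\setminus\{0\}\to V$ with $\nu(x+y)\geq\min\{\nu(x),\nu(y)\}$, $\nu(cx)=\nu(x)$ for $c\in\mathbb K^*$, and $\nu(xy)=\nu(x)+\nu(y)$,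 whenever $x,y$ and, respectively, $x+y$, $xy$ are non-zero. It is positive if $\nu(x)>0$ for every homogeneous element $x\in A$ that is non-zero and non-invertible. -/

import Mathlib

namespace LSAlg

/-- The greatest common divisor of the labels `b` of the consecutive pairs of a list
(`0` if there are no consecutive pairs). -/
def bondGcd {S : Type*} (b : S → S → ℕ) : List S → ℕ
  | [] => 0
  | [_] => 0
  | σ :: τ :: l => Nat.gcd (b σ τ) (bondGcd b (τ :: l))

/-- The list `l` is a maximal chain `σ = η₁ < η₂ < ⋯ < η_r = τ` from `σ` to `τ`:
each element is covered by the next one. -/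
structure IsMaximalChainBetween {S : Type*} [PartialOrder S] (σ τ : S) (l : List S) : Prop where
  isChain : l.IsChain (· ⋖ ·)
  head_eq : l.head? = some σ
  last_eq : l.getLast? = some τ

/-- A set of bonds on a poset. The values of `bond` on pairs `(σ, τ)` such that `τ` does not cover
`σ` are irrelevant. -/
structure Bonds (S : Type*) [PartialOrder S] where
  /-- the bond of a covering pair -/
  bond : S → S → ℕ
  bond_pos : ∀ σ τ, σ ⋖ τ → 0 < bond σ τ
  gcd_eq : ∀ σ τ l₁ l₂, IsMaximalChainBetween σ τ l₁ → IsMaximalChainBetween σ τ l₂ →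
    bondGcd bond l₁ = bondGcd bond l₂

open scoped Classical in
/-- The extension of the bonds to comparable pairs `σ ≤ τ`: the greatest common divisor of the
bonds along any maximal chain from `σ` to `τ` (and `0` if there is no such chain). -/
noncomputable def Bonds.ext {S : Type*} [PartialOrder S] (b : Bonds S) (σ τ : S) : ℕ :=
  if h : ∃ l, IsMaximalChainBetween σ τ l then bondGcd b.bond h.choose else 0

theorem Bonds.ext_eq {S : Type*} [PartialOrder S] (b : Bonds S) {σ τ : S} {l : List S}
    (hl : IsMaximalChainBetween σ τ l) : b.ext σ τ = bondGcd b.bond l := by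
  have h : ∃ l, IsMaximalChainBetween σ τ l := ⟨l, hl⟩
  rw [Bonds.ext, dif_pos h]
  exact b.gcd_eq σ τ _ _ h.choose_spec hl

open scoped Classical in
/-- `π(σ₁) + ⋯ + π(σ_j)` for `σ = σ_j` in the (totally ordered) support of `π`. -/
noncomputable def partialSum {S : Type*} [PartialOrder S] [Fintype S] (π : S → ℚ) (σ : S) : ℚ :=
  ∑ η : S with η ≤ σ, π η

/-- The function `π : S → ℚ` is an LS path of degree `r`. -/
structure IsLSPath {S : Type*} [PartialOrder S] [Fintype S] (b : Bonds S) (r : ℕ)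
    (π : S → ℚ) : Prop where
  nonneg : ∀ σ, 0 ≤ π σ
  isChain : IsChain (· ≤ ·) (Function.support π)
  /-- the integrality condition for consecutive elements `σ < τ` of the support -/
  integral : ∀ σ ∈ Function.support π, ∀ τ ∈ Function.support π, σ < τ →
    (∀ η ∈ Function.support π, ¬ (σ < η ∧ η < τ)) →
    ∃ n : ℕ, (b.ext σ τ : ℚ) * partialSum π σ = n
  sum_eq : ∑ σ, π σ = r

/-- LS paths of arbitrary degree. -/
structure LSPath {S : Type*} [PartialOrder S] [Fintype S] (b : Bonds S) where
  /-- the underlying function -/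
  toFun : S → ℚ
  /-- the degree -/
  degree : ℕ
  isLSPath : IsLSPath b degree toFun

/-- LS paths of degree `1`. -/
abbrev LSPathOne {S : Type*} [PartialOrder S] [Fintype S] (b : Bonds S) : Type _ :=
  {π : LSPath b // π.degree = 1}

section Extremal

variable {S : Type*} [PartialOrder S] [Fintype S]

theorem LSPath.ext_toFun {b : Bonds S} {π π' : LSPath b} (h : π.toFun = π'.toFun) : π = π' := by
  obtain ⟨f, r, hf⟩ := π
  obtain ⟨f', r', hf'⟩ := π'
  obtain rfl : f = f' := h
  have : (r : ℚ) = r' := hf.sum_eq.symm.trans hf'.sum_eq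
  obtain rfl : r = r' := by exact_mod_cast this
  rfl

open scoped Classical in
/-- The function `r σ`. -/
noncomputable def extremalFun (r : ℕ) (σ : S) : S → ℚ := fun η => if η = σ then (r : ℚ) else 0

theorem isLSPath_extremalFun (b : Bonds S) (r : ℕ) (σ : S) : IsLSPath b r (extremalFun r σ) where
  nonneg η := by unfold extremalFun; split_ifs <;> positivity
  isChain := by
    have h : ∀ η ∈ Function.support (extremalFun r σ), η = σ := by
      intro η hη
      by_contra hne
      exact hη (by simp [extremalFun, hne])
    intro η hη η' hη' hne
    exact absurd ((h η hη).trans (h η' hη').symm) hne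
  integral := by
    have h : ∀ η ∈ Function.support (extremalFun r σ), η = σ := by
      intro η hη
      by_contra hne
      exact hη (by simp [extremalFun, hne])
    intro η hη η' hη' hlt _
    exact absurd ((h η hη).trans (h η' hη').symm) hlt.ne
  sum_eq := by
    classical
    simp [extremalFun, Finset.sum_ite_eq']

/-- The extremal LS path `r σ` of degree `r` and support `{σ}`. -/
noncomputable def extremal (b : Bonds S) (r : ℕ) (σ : S) : LSPath b :=
  ⟨extremalFun r σ, r, isLSPath_extremalFun b r σ⟩

/-- The extremal LS path `σ` of degree `1`. -/
noncomputable def extremalOne (b : Bonds S) (σ : S) : LSPathOne b :=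
  ⟨extremal b 1 σ, rfl⟩

end Extremal

section Standard

variable {S : Type*} [PartialOrder S] [Fintype S]

/-- `max supp π ≤ min supp π'`. -/
def Precedes (π π' : S → ℚ) : Prop :=
  ∀ σ ∈ Function.support π, ∀ τ ∈ Function.support π', σ ≤ τ

/-- The (ordered) monomial `π₁ π₂ ⋯ π_r` in LS paths of degree `1` is standard:
`max supp π_h ≤ min supp π_k` for `h < k`. As the supports are non-empty, it is equivalent to ask
this for consecutive indices only. -/
def IsStandard {b : Bonds S} (l : List (LSPathOne b)) : Prop :=
  l.Pairwise fun π π' => Precedes π.1.toFun π'.1.toFun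

/-- The standard monomial `l` in LS paths of degree `1` is the canonical form of `π`. -/
def IsCanonicalForm {b : Bonds S} (π : LSPath b) (l : List (LSPathOne b)) : Prop :=
  IsStandard l ∧ (l.map fun π' => π'.1.toFun).sum = π.toFun

end Standard

/-! ### Existence of canonical forms -/

section Existence

variable {S : Type*} [PartialOrder S] [Fintype S]

/-- Truncation of a rational number to the unit interval. -/
def clamp (t : ℚ) : ℚ := max 0 (min 1 t)

theorem clamp_mono : Monotone clamp := fun _ _ h =>
  max_le_max le_rfl (min_le_min le_rfl h)

theorem clamp_of_nonpos {t : ℚ} (h : t ≤ 0) : clamp t = 0 := by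
  unfold clamp; rw [min_eq_right (by linarith), max_eq_left h]

theorem clamp_of_one_le {t : ℚ} (h : 1 ≤ t) : clamp t = 1 := by
  unfold clamp; rw [min_eq_left h]; norm_num

theorem clamp_of_mem {t : ℚ} (h0 : 0 ≤ t) (h1 : t ≤ 1) : clamp t = t := by
  unfold clamp; rw [min_eq_right h1, max_eq_right h0]

theorem sum_clamp (r : ℕ) (t : ℚ) (ht : 0 ≤ t) :
    ∑ h ∈ Finset.range r, clamp (t - h) = min t r := by
  induction r with
  | zero => simp [ht]
  | succ r ih =>
    rw [Finset.sum_range_succ, ih]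
    push_cast
    rcases le_total t r with h | h
    · rw [min_eq_left h, min_eq_left (by linarith), clamp_of_nonpos (by linarith)]; ring
    · rw [min_eq_right h]
      rcases le_total t (r + 1) with h' | h'
      · rw [min_eq_left h', clamp_of_mem (by linarith) (by linarith)]; ring
      · rw [min_eq_right h', clamp_of_one_le (by linarith)]

open scoped Classical in
theorem telescope (π : S → ℚ) (f : ℚ → ℚ) (n : ℕ) : ∀ T : Finset S, T.card = n →
    IsChain (· ≤ ·) (T : Set S) →
    ∑ η ∈ T, (f (∑ ξ ∈ T with ξ ≤ η, π ξ) - f (∑ ξ ∈ T with ξ < η, π ξ))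
      = f (∑ ξ ∈ T, π ξ) - f 0 := by
  induction n with
  | zero =>
    intro T hT _
    rw [Finset.card_eq_zero.1 hT]; simp
  | succ n ih =>
    intro T hT hc
    have hne : T.Nonempty := by rw [← Finset.card_pos]; omega
    obtain ⟨m, hm⟩ := T.exists_maximal hne
    have hmT : m ∈ T := hm.1
    have hle : ∀ η ∈ T, η ≤ m := by
      intro η hη
      rcases hc.total hη hmT with h | h
      · exact h
      · exact hm.2 hη h
    have h1 : T.filter (· ≤ m) = T := Finset.filter_true_of_mem hle
    have h2 : T.filter (· < m) = T.erase m := by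
      ext η
      simp only [Finset.mem_filter, Finset.mem_erase]
      constructor
      · rintro ⟨h, h'⟩; exact ⟨h'.ne, h⟩
      · rintro ⟨h, h'⟩; exact ⟨h', lt_of_le_of_ne (hle η h') h⟩
    have h3 : ∀ η ∈ T.erase m, T.filter (· ≤ η) = (T.erase m).filter (· ≤ η) := by
      intro η hη
      ext ξ
      simp only [Finset.mem_filter, Finset.mem_erase] at hη ⊢
      constructor
      · rintro ⟨h, h'⟩
        refine ⟨⟨?_, h⟩, h'⟩
        rintro rfl
        exact hη.1 (le_antisymm (hle η hη.2) h')
      · rintro ⟨⟨_, h⟩, h'⟩; exact ⟨h, h'⟩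
    have h4 : ∀ η ∈ T.erase m, T.filter (· < η) = (T.erase m).filter (· < η) := by
      intro η hη
      ext ξ
      simp only [Finset.mem_filter, Finset.mem_erase] at hη ⊢
      constructor
      · rintro ⟨h, h'⟩
        refine ⟨⟨?_, h⟩, h'⟩
        rintro rfl
        exact hη.1 (le_antisymm (hle η hη.2) h'.le)
      · rintro ⟨⟨_, h⟩, h'⟩; exact ⟨h, h'⟩
    rw [← Finset.add_sum_erase T _ hmT, h1, h2, ← Finset.add_sum_erase T π hmT]
    have h5 := ih (T.erase m) (by rw [Finset.card_erase_of_mem hmT]; omega)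
      (hc.mono (by simp))
    have h6 : ∑ η ∈ T.erase m, (f (∑ ξ ∈ T with ξ ≤ η, π ξ) - f (∑ ξ ∈ T with ξ < η, π ξ)) =
        ∑ η ∈ T.erase m, (f (∑ ξ ∈ T.erase m with ξ ≤ η, π ξ) -
          f (∑ ξ ∈ T.erase m with ξ < η, π ξ)) :=
      Finset.sum_congr rfl fun η hη => by rw [h3 η hη, h4 η hη]
    rw [h6, h5]
    ring

open scoped Classical in
/-- `π(σ₁) + ⋯ + π(σ_{j-1})` for `σ = σ_j` in the (totally ordered) support of `π`. -/
noncomputable def strictPartialSum (π : S → ℚ) (σ : S) : ℚ := ∑ η : S with η < σ, π η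

/-- The `h`-th factor of the canonical form of `π`. -/
noncomputable def slice (π : S → ℚ) (h : ℕ) (σ : S) : ℚ :=
  clamp (partialSum π σ - h) - clamp (strictPartialSum π σ - h)

theorem partialSum_eq (π : S → ℚ) (σ : S) : partialSum π σ = π σ + strictPartialSum π σ := by
  classical
  unfold partialSum strictPartialSum
  rw [show (Finset.univ.filter (· ≤ σ)) = insert σ (Finset.univ.filter (· < σ)) by
    ext η; simp [le_iff_eq_or_lt], Finset.sum_insert (by simp)]

theorem sum_slice_aux (π : S → ℚ) (hc : IsChain (· ≤ ·) (Function.support π)) (h : ℕ)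
    (D : Set S) (hD : IsLowerSet D) :
    (open scoped Classical in ∑ η : S with η ∈ D, slice π h η) =
      (open scoped Classical in clamp ((∑ η : S with η ∈ D, π η) - h)) := by
  classical
  set T : Finset S := Finset.univ.filter (fun η => η ∈ D ∧ π η ≠ 0) with hT
  have key := telescope π (fun t => clamp (t - h)) T.card T rfl
    (hc.mono (by intro η; simp [hT]))
  have hle : ∀ η ∈ T, ∑ ξ ∈ T with ξ ≤ η, π ξ = partialSum π η := by
    intro η hη
    unfold partialSum
    refine Finset.sum_subset (fun ξ => by simp) ?_
    intro ξ h1 h2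
    simp only [hT, Finset.mem_filter, Finset.mem_univ, true_and] at hη h1 h2
    by_contra h3
    exact h2 ⟨⟨hD h1 hη.1, h3⟩, h1⟩
  have hlt : ∀ η ∈ T, ∑ ξ ∈ T with ξ < η, π ξ = strictPartialSum π η := by
    intro η hη
    unfold strictPartialSum
    refine Finset.sum_subset (fun ξ => by simp) ?_
    intro ξ h1 h2
    simp only [hT, Finset.mem_filter, Finset.mem_univ, true_and] at hη h1 h2
    by_contra h3
    exact h2 ⟨⟨hD h1.le hη.1, h3⟩, h1⟩
  rw [Finset.sum_congr rfl (fun η hη => by rw [hle η hη, hlt η hη])] at key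
  have hsub : T ⊆ Finset.univ.filter (fun η => η ∈ D) := by
    intro η; simp only [hT, Finset.mem_filter]; tauto
  have hz : ∀ η ∈ Finset.univ.filter (fun η => η ∈ D), η ∉ T → π η = 0 := by
    intro η h1 h2
    simp only [hT, Finset.mem_filter, Finset.mem_univ, true_and] at h1 h2
    by_contra h3
    exact h2 ⟨h1, h3⟩
  rw [Finset.sum_subset hsub hz, Finset.sum_subset hsub (fun η h1 h2 => by
      rw [partialSum_eq, hz η h1 h2]; simp), clamp_of_nonpos (t := 0 - (h : ℚ)) (by simp)] at key
  simpa [slice] using key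

theorem strictPartialSum_nonneg {π : S → ℚ} (h0 : ∀ σ, 0 ≤ π σ) (σ : S) :
    0 ≤ strictPartialSum π σ :=
  Finset.sum_nonneg fun _ _ => h0 _

theorem partialSum_le_strictPartialSum {π : S → ℚ} (h0 : ∀ σ, 0 ≤ π σ) {σ τ : S} (h : σ < τ) :
    partialSum π σ ≤ strictPartialSum π τ := by
  classical
  refine Finset.sum_le_sum_of_subset_of_nonneg ?_ fun _ _ _ => h0 _
  intro η
  simp only [Finset.mem_filter, Finset.mem_univ, true_and]
  exact fun h' => h'.trans_lt h

theorem slice_nonneg {π : S → ℚ} (h0 : ∀ σ, 0 ≤ π σ) (h : ℕ) (σ : S) : 0 ≤ slice π h σ := by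
  unfold slice
  have := clamp_mono (show strictPartialSum π σ - (h : ℚ) ≤ partialSum π σ - h by
    rw [partialSum_eq]; linarith [h0 σ])
  linarith

theorem slice_ne_zero {π : S → ℚ} {h : ℕ} {σ : S} (h0 : ∀ σ, 0 ≤ π σ) (hs : slice π h σ ≠ 0) :
    π σ ≠ 0 ∧ (h : ℚ) < partialSum π σ ∧ strictPartialSum π σ < h + 1 := by
  have hle : strictPartialSum π σ ≤ partialSum π σ := by rw [partialSum_eq]; linarith [h0 σ]
  refine ⟨fun h' => hs ?_, ?_, ?_⟩
  · unfold slice; rw [partialSum_eq, h']; simp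
  · by_contra h'
    rw [not_lt] at h'
    apply hs
    unfold slice
    rw [clamp_of_nonpos (by linarith), clamp_of_nonpos (by linarith)]; simp
  · by_contra h'
    rw [not_lt] at h'
    apply hs
    unfold slice
    rw [clamp_of_one_le (by linarith), clamp_of_one_le (by linarith)]; simp

theorem isLSPath_slice {b : Bonds S} {r : ℕ} {π : S → ℚ} (hπ : IsLSPath b r π) {h : ℕ}
    (hr : h < r) : IsLSPath b 1 (slice π h) where
  nonneg := slice_nonneg hπ.nonneg h
  isChain := hπ.isChain.mono fun _ hσ => (slice_ne_zero hπ.nonneg hσ).1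
  integral := by
    intro σ hσ τ hτ hlt hcons
    obtain ⟨hσ1, hσ2, -⟩ := slice_ne_zero hπ.nonneg hσ
    obtain ⟨hτ1, -, hτ3⟩ := slice_ne_zero hπ.nonneg hτ
    have hστ := partialSum_le_strictPartialSum hπ.nonneg hlt
    have hsum : partialSum (slice π h) σ = partialSum π σ - h := by
      have := sum_slice_aux π hπ.isChain h (Set.Iic σ) (isLowerSet_Iic σ)
      change partialSum (slice π h) σ = clamp (partialSum π σ - h) at this
      rw [this, clamp_of_mem (by linarith) (by linarith)]
    obtain ⟨n, hn⟩ := hπ.integral σ hσ1 τ hτ1 hlt (by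
      rintro η hη ⟨h1, h2⟩
      refine hcons η ?_ ⟨h1, h2⟩
      have h3 := partialSum_le_strictPartialSum hπ.nonneg h1
      have h4 := partialSum_le_strictPartialSum hπ.nonneg h2
      have h5 := partialSum_eq π η
      have h6 : 0 < π η := lt_of_le_of_ne (hπ.nonneg η) (Ne.symm hη)
      rw [Function.mem_support, slice, clamp_of_mem (by linarith) (by linarith),
        clamp_of_mem (by linarith) (by linarith)]
      intro h7
      linarith)
    rw [hsum, mul_sub, hn]
    have hnn : (0 : ℚ) ≤ (b.ext σ τ : ℚ) * (partialSum π σ - h) :=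
      mul_nonneg (by positivity) (by linarith)
    rw [mul_sub, hn] at hnn
    have hle : b.ext σ τ * h ≤ n := by
      have : ((b.ext σ τ * h : ℕ) : ℚ) ≤ n := by push_cast; linarith
      exact_mod_cast this
    exact ⟨n - b.ext σ τ * h, by push_cast [Nat.cast_sub hle]; ring⟩
  sum_eq := by
    have := sum_slice_aux π hπ.isChain h Set.univ isLowerSet_univ
    simp only [Set.mem_univ, Finset.filter_true] at this
    rw [this, hπ.sum_eq, clamp_of_one_le]
    · simp
    · have : (h : ℚ) + 1 ≤ r := by exact_mod_cast hr
      linarith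

theorem partialSum_le_degree {b : Bonds S} {r : ℕ} {π : S → ℚ} (hπ : IsLSPath b r π) (σ : S) :
    partialSum π σ ≤ r := by
  classical
  rw [← hπ.sum_eq]
  exact Finset.sum_le_sum_of_subset_of_nonneg (Finset.subset_univ _) fun _ _ _ => hπ.nonneg _

theorem sum_slices {b : Bonds S} {r : ℕ} {π : S → ℚ} (hπ : IsLSPath b r π) (σ : S) :
    ∑ h ∈ Finset.range r, slice π h σ = π σ := by
  have h1 := strictPartialSum_nonneg hπ.nonneg σ
  have h2 := partialSum_eq π σ
  have h3 := hπ.nonneg σ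
  have h4 := partialSum_le_degree hπ σ
  unfold slice
  rw [Finset.sum_sub_distrib, sum_clamp _ _ (by linarith), sum_clamp _ _ h1,
    min_eq_left h4, min_eq_left (by linarith)]
  linarith

theorem exists_isCanonicalForm {b : Bonds S} (π : LSPath b) :
    ∃ l : List (LSPathOne b), IsCanonicalForm π l := by
  have hπ := π.isLSPath
  refine ⟨List.ofFn fun h : Fin π.degree =>
    ⟨⟨slice π.toFun h, 1, isLSPath_slice hπ h.2⟩, rfl⟩, ?_, ?_⟩
  · unfold IsStandard
    rw [List.pairwise_ofFn]
    intro h k hhk σ hσ τ hτ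
    obtain ⟨hσ1, -, hσ3⟩ := slice_ne_zero hπ.nonneg hσ
    obtain ⟨hτ1, hτ2, -⟩ := slice_ne_zero hπ.nonneg hτ
    by_contra hn
    have hlt : τ < σ := by
      rcases hπ.isChain.total hτ1 hσ1 with h' | h'
      · exact lt_of_le_of_ne h' fun h'' => hn h''.ge
      · exact absurd h' hn
    have h1 := partialSum_le_strictPartialSum hπ.nonneg hlt
    have h2 : ((h : ℕ) : ℚ) + 1 ≤ (k : ℕ) := by exact_mod_cast hhk
    linarith
  · rw [List.map_ofFn, List.sum_ofFn]
    funext σ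
    rw [Finset.sum_apply]
    simp only [Function.comp]
    rw [Fin.sum_univ_eq_sum_range (fun h => slice π.toFun h σ)]
    exact sum_slices hπ σ

end Existence

/-! ### Orders on functions -/

section Order

variable {S : Type*}

/-- The reverse lexicographic order on `ℚ^S` with respect to a total order `t` on `S`. -/
def RevLexLE (t : LinearOrder S) (π π' : S → ℚ) : Prop :=
  π = π' ∨ ∃ σ, π σ < π' σ ∧ ∀ τ, t.lt σ τ → π τ = π' τ

/-- The partial order `π ⊴ π'` on `ℚ^S`: the reverse lexicographic inequality holds for every total
order refining the order of `S`. -/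
def TriLE [PartialOrder S] (π π' : S → ℚ) : Prop :=
  ∀ t : LinearOrder S, (∀ σ τ : S, σ ≤ τ → t.le σ τ) → RevLexLE t π π'

end Order

/-! ### LS algebras -/

section Algebra

variable {S : Type*} [PartialOrder S] [Fintype S]

/-- The canonical form of an LS path. -/
noncomputable def canonicalForm {b : Bonds S} (π : LSPath b) : List (LSPathOne b) :=
  (exists_isCanonicalForm π).choose

/-- The extension to all LS paths, through canonical forms, of a map defined on the LS paths of
degree `1`. -/
noncomputable def pathElem {b : Bonds S} {A : Type*} [CommRing A] (x : LSPathOne b → A)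
    (π : LSPath b) : A :=
  ((canonicalForm π).map x).prod

/-- The homogeneous part of degree `r`: the span of the LS paths of degree `r`. -/
noncomputable def degreePart (K : Type*) {A : Type*} [Field K] [CommRing A] [Algebra K A]
    {b : Bonds S} (x : LSPathOne b → A) (r : ℕ) : Submodule K A :=
  Submodule.span K (pathElem x '' {π | π.degree = r})

/-- The monomial `π₁ π₂` is non-standard, in either order of the factors. -/
def NonStandard {b : Bonds S} (π₁ π₂ : LSPathOne b) : Prop :=
  ¬ IsStandard [π₁, π₂] ∧ ¬ IsStandard [π₂, π₁]

/-- The linear combination `c` of LS paths is (the right hand side of) the straightening relation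
of the non-standard monomial `π₁ π₂`. An LS path of degree `2` stands for its canonical form, that
is for a standard monomial `π_{j,1} π_{j,2}`, and is equal to `π_{j,1} + π_{j,2}` as a function. -/
def IsStraightening (K : Type*) {A : Type*} [Field K] [CommRing A] [Algebra K A]
    {b : Bonds S} (x : LSPathOne b → A) (π₁ π₂ : LSPathOne b) (c : LSPath b →₀ K) : Prop :=
  NonStandard π₁ π₂ ∧ x π₁ * x π₂ = Finsupp.linearCombination K (pathElem x) c

/-- `A` is an LS algebra over the poset with bonds `(S, ≤, b)` with respect to the map `x` from the
LS paths of degree `1` to `A` (the map `x` is then injective by linear independence). -/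
structure IsLSAlgebra (K : Type*) {A : Type*} [Field K] [CommRing A] [Algebra K A]
    (b : Bonds S) (x : LSPathOne b → A) : Prop where
  /-- the LS paths are a basis: linear independence -/
  linearIndependent : LinearIndependent K (pathElem x)
  /-- the LS paths are a basis: generation -/
  span_eq_top : Submodule.span K (Set.range (pathElem x)) = ⊤
  /-- the degree induces a grading of the algebra `A` (that `A` is the direct sum of the
  homogeneous parts is clear as the LS paths are a basis) -/
  graded : SetLike.GradedMonoid (degreePart K x)
  /-- order condition on the straightening relations -/
  order : ∀ (π₁ π₂ : LSPathOne b) (c : LSPath b →₀ K), IsStraightening K x π₁ π₂ c →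
    ∀ π ∈ c.support, TriLE (π₁.1.toFun + π₂.1.toFun) π.toFun
  /-- if the supports are comparable then the LS path `π₁ + π₂` has coefficient `1` -/
  canonical : ∀ (π₁ π₂ : LSPathOne b) (c : LSPath b →₀ K), IsStraightening K x π₁ π₂ c →
    IsChain (· ≤ ·) (Function.support π₁.1.toFun ∪ Function.support π₂.1.toFun) →
    ∀ π : LSPath b, π.toFun = π₁.1.toFun + π₂.1.toFun → c π = 1

/-- `lam` is a system of weights: it is additive, and the straightening relations are
homogeneous. -/
structure IsSystemOfWeights (K : Type*) {A : Type*} [Field K] [CommRing A] [Algebra K A]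
    {b : Bonds S} (x : LSPathOne b → A) {Λ : Type*} [AddCommGroup Λ] (lam : LSPath b → Λ) :
    Prop where
  /-- additivity, whenever the sum of two LS paths is an LS path -/
  add : ∀ π₁ π₂ π : LSPath b, π.toFun = π₁.toFun + π₂.toFun → lam π = lam π₁ + lam π₂
  homogeneous : ∀ (π₁ π₂ : LSPathOne b) (c : LSPath b →₀ K), IsStraightening K x π₁ π₂ c →
    ∀ π ∈ c.support, lam π = lam π₁.1 + lam π₂.1

/-- A system of weights is effective if `σ^r` is the unique LS path of degree `r` and
weight `r λ(σ)`. -/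
def IsEffective {b : Bonds S} {Λ : Type*} [AddCommGroup Λ] (lam : LSPath b → Λ) : Prop :=
  ∀ (σ : S) (r : ℕ) (π : LSPath b), π.degree = r → lam π = r • lam (extremal b 1 σ) →
    π = extremal b r σ

/-- The ideal `I_τ` generated by the LS paths `π` with `max supp π ≰ τ`. -/
noncomputable def pathIdeal {A : Type*} [CommRing A] {b : Bonds S} (x : LSPathOne b → A) (τ : S) :
    Ideal A :=
  Ideal.span (pathElem x '' {π | ∃ σ ∈ Function.support π.toFun, ¬ σ ≤ τ})

universe w

/-- `A` is an LS algebra of flag type over `(S, ≤, b)` with respect to `x`. -/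
structure IsFlagType (K : Type*) {A : Type*} [Field K] [CommRing A] [Algebra K A]
    (b : Bonds S) (x : LSPathOne b → A) : Prop where
  isLSAlgebra : IsLSAlgebra K b x
  effective : ∃ (Λ : Type w) (_ : AddCommGroup Λ) (_ : Module.Free ℤ Λ) (lam : LSPath b → Λ),
    IsSystemOfWeights K x lam ∧ IsEffective lam
  isDomain : ∀ τ : S, IsDomain (A ⧸ pathIdeal x τ)

end Algebra

/-! ### Valuations -/

section Valuation

/-- A valuation on the `K`-algebra `A` with values in a totally ordered abelian group `V`; it is
a map on the non-zero elements, the value at `0` is irrelevant. -/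
structure IsValuation (K : Type*) {A V : Type*} [Field K] [CommRing A] [Algebra K A]
    [AddCommGroup V] [LinearOrder V] [IsOrderedAddMonoid V] (ν : A → V) : Prop where
  min_le_add : ∀ x y : A, x ≠ 0 → y ≠ 0 → x + y ≠ 0 → min (ν x) (ν y) ≤ ν (x + y)
  smul_eq : ∀ (c : K) (x : A), c ≠ 0 → x ≠ 0 → ν (c • x) = ν x
  mul_eq : ∀ x y : A, x ≠ 0 → y ≠ 0 → x * y ≠ 0 → ν (x * y) = ν x + ν y

/-- The map `ν` on the graded algebra with homogeneous parts `𝒜 r` is positive: it is positive on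
the non-zero and non-invertible homogeneous elements. -/
def IsPositive {K A V : Type*} [Field K] [CommRing A] [Algebra K A] [AddCommGroup V]
    [LinearOrder V] (𝒜 : ℕ → Submodule K A) (ν : A → V) : Prop :=
  ∀ x : A, SetLike.IsHomogeneousElem 𝒜 x → x ≠ 0 → ¬ IsUnit x → 0 < ν x

/-- The group `ℚ^C` for a maximal chain `C`; it is ordered by the reverse lexicographic order:
`v < v'` if `v σ < v' σ` for the largest `σ` in `C` with `v σ ≠ v' σ`. -/
abbrev ChainSpace {S : Type*} [PartialOrder S] (C : Flag S) : Type _ := Colex (C → ℚ)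

open scoped Classical in
noncomputable instance flagLinearOrder {S : Type*} [PartialOrder S] (C : Flag S) : LinearOrder C :=
  inferInstance

noncomputable instance chainSpaceLinearOrder {S : Type*} [PartialOrder S] [Finite S]
    (C : Flag S) : LinearOrder (ChainSpace C) :=
  Pi.Colex.linearOrder

theorem chainSpace_lt_iff {S : Type*} [PartialOrder S] [Finite S] {C : Flag S}
    {u v : ChainSpace C} : u < v ↔ ∃ σ : C, (∀ τ : C, σ < τ → u τ = v τ) ∧ u σ < v σ :=
  Iff.rfl

instance chainSpaceIsOrderedAddMonoid {S : Type*} [PartialOrder S] [Finite S] (C : Flag S) :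
    @IsOrderedAddMonoid (ChainSpace C) _ (chainSpaceLinearOrder C).toPartialOrder.toPreorder :=
  letI := chainSpaceLinearOrder C
  { add_le_add_left := fun u v huv w => by
      rcases eq_or_lt_of_le huv with rfl | h
      · exact le_rfl
      · obtain ⟨i, hi, hlt⟩ := chainSpace_lt_iff.1 h
        refine le_of_lt (chainSpace_lt_iff.2 ⟨i, fun j hj => ?_, ?_⟩)
        · exact congrArg (· + w j) (hi j hj)
        · exact add_lt_add_left hlt (w i) }

open scoped Classical in
/-- The element `σ` of `ℚ^C`. -/
noncomputable def chainVec {S : Type*} [PartialOrder S] {C : Flag S} (σ : C) : ChainSpace C :=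
  toColex fun η => if η = σ then 1 else 0

end Valuation

end LSAlg

/-! The ideals `pathIdeal x σ`, for `σ` in the flag `C`, are primes that decrease as `σ` grows, down
to `0` at `⊤`; in particular `A` is a domain. For `σ < τ` in `C` the element `τ` of `A` lies in the
prime of `σ`, while no power of the element `σ` does.

A chain of primes of a domain is dominated by one valuation ring of the fraction field, obtained by
composing places centred at the successive primes (`exists_valuationSubring_chain`). Its additive
valuation `w` satisfies `w c < w a` whenever some prime of the chain contains `a ≠ 0` but not `c`.
Hence `m • w σ < w τ` for all `m`: the values along `C` have strictly increasing orders of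
magnitude. A maximal ideal above all paths of positive degree, added at the large end of the chain,
makes `w` positive on these paths.

It remains to replace the value group by `ℚ^C`, and this is a count. LS paths have chains as
supports and bounded denominators, so those of degree at most `r` number `O(r ^ n)`, with `n ≤ |C|`
the number of grades. Monomials with distinct values are linearly independent, so among `|C| + 1`
nonzero elements two distinct monomials share a value (`IsLSAlgebra.exists_monomials`). Applied to
`a` and the elements of `C`, this gives an integral relation in which `w a` has a nonzero
coefficient, since the values along `C` are independent. So `w a` has rational coordinates, stated
with cleared denominators as the value group need not be divisible. The orders of magnitude turn the
order of values into the reverse lexicographic order of coordinates (`HasCoordinates.lt`), and `ν a`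
is the coordinate vector of `w a`. -/

namespace LSAlg

/-! ### Composition of places and valuation rings dominating a chain of primes -/

section Places

/-- The composition of a place of `L`, given by `O`, with a place of its residue field. -/
def compValuationSubring {L : Type*} [Field L] (O : ValuationSubring L)
    (O' : ValuationSubring (IsLocalRing.ResidueField O)) : ValuationSubring L :=
  ValuationSubring.ofSubring ((O'.toSubring.comap (IsLocalRing.residue O)).map O.subtype) <| by
    -- Nonunits of `O` reduce to `0`, so only units of `O` need the dichotomy of `O'`.
    have key : ∀ x : L, x ∈ O.nonunits →
        x ∈ (O'.toSubring.comap (IsLocalRing.residue O)).map O.subtype := by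
      intro x hx
      obtain ⟨hxO, hx⟩ := ValuationSubring.mem_nonunits_iff_exists_mem_maximalIdeal.1 hx
      refine ⟨⟨x, hxO⟩, ?_, rfl⟩
      change IsLocalRing.residue O _ ∈ O'
      rw [(IsLocalRing.residue_eq_zero_iff _).2 hx]
      exact O'.zero_mem
    intro x
    by_cases hxO : x ∈ O
    · by_cases hxi : x⁻¹ ∈ O
      · have hm : IsLocalRing.residue O ⟨x, hxO⟩ ∈ O' ∨ IsLocalRing.residue O ⟨x⁻¹, hxi⟩ ∈ O' := by
          -- As `0⁻¹ = 0`, the element `0` also reaches this branch.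
          by_cases hx0 : x = 0
          · left
            have : (⟨x, hxO⟩ : O) = 0 := Subtype.ext hx0
            rw [this, map_zero]
            exact O'.zero_mem
          have h1 : IsLocalRing.residue O ⟨x, hxO⟩ * IsLocalRing.residue O ⟨x⁻¹, hxi⟩ = 1 := by
            rw [← map_mul, ← map_one (IsLocalRing.residue O)]
            congr 1
            exact Subtype.ext (mul_inv_cancel₀ hx0)
          rw [eq_inv_of_mul_eq_one_right h1]
          exact O'.mem_or_inv_mem _
        exact hm.imp (fun h => ⟨_, h, rfl⟩) fun h => ⟨_, h, rfl⟩
      · by_cases hx0 : x = 0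
        · exact Or.inl (hx0 ▸ Subring.zero_mem _)
        · exact Or.inl (key x ((ValuationSubring.mem_nonunits_iff_or _).2 (Or.inr hxi)))
    · exact Or.inr (key _ ((ValuationSubring.inv_mem_nonunits_iff _).2 (Or.inr hxO)))

theorem mem_compValuationSubring {L : Type*} [Field L] {O : ValuationSubring L}
    {O' : ValuationSubring (IsLocalRing.ResidueField O)} {x : L} :
    x ∈ compValuationSubring O O' ↔ ∃ h : x ∈ O, IsLocalRing.residue O ⟨x, h⟩ ∈ O' := by
  constructor
  · rintro ⟨y, hy, rfl⟩
    exact ⟨y.2, hy⟩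
  · rintro ⟨h, h'⟩
    exact ⟨⟨x, h⟩, h', rfl⟩

/-- If `x⁻¹` were in the composite ring, its residue would be an inverse in `O'` of a nonunit of
`O'`. -/
theorem mem_nonunits_compValuationSubring {L : Type*} [Field L] {O : ValuationSubring L}
    {O' : ValuationSubring (IsLocalRing.ResidueField O)} {x : L} (hx : x ∈ O)
    (h : IsLocalRing.residue O ⟨x, hx⟩ ∈ O'.nonunits) :
    x ∈ (compValuationSubring O O').nonunits := by
  rw [ValuationSubring.mem_nonunits_iff_or, mem_compValuationSubring]
  by_cases hx0 : x = 0
  · exact Or.inl hx0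
  refine Or.inr ?_
  rintro ⟨h1, h2⟩
  have h3 : IsLocalRing.residue O ⟨x, hx⟩ * IsLocalRing.residue O ⟨x⁻¹, h1⟩ = 1 := by
    rw [← map_mul, ← map_one (IsLocalRing.residue O)]
    congr 1
    exact Subtype.ext (mul_inv_cancel₀ hx0)
  rw [eq_inv_of_mul_eq_one_right h3] at h2
  rcases (ValuationSubring.mem_nonunits_iff_or _).1 h with h4 | h4
  · rw [h4, zero_mul] at h3
    exact zero_ne_one h3
  · exact h4 h2

/-- Every prime containing the kernel of a map to a field is the centre of a valuation ring. -/
theorem exists_valuationSubring_center {R L : Type*} [CommRing R] [Field L] (φ : R →+* L)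
    (P : Ideal R) [P.IsPrime] (h : RingHom.ker φ ≤ P) :
    ∃ O : ValuationSubring L, (∀ r, φ r ∈ O) ∧ ∀ r, φ r ∈ O.nonunits ↔ r ∈ P := by
  have hu : ∀ y : P.primeCompl, IsUnit (φ y) := fun y =>
    isUnit_iff_ne_zero.2 fun h0 => y.2 (h h0)
  -- Elements outside `P` avoid the kernel, so `φ` extends to the local ring at `P`. A valuation
  -- ring dominating it contracts to the maximal ideal there, hence to `P` in `R`.
  let f : Localization.AtPrime P →+* L := IsLocalization.lift hu
  obtain ⟨O, hO, hl⟩ := IsLocalRing.exists_factor_valuationRing f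
  have hf : ∀ r, f (algebraMap R _ r) = φ r := fun r => IsLocalization.lift_eq hu r
  have hφ : ∀ r, φ r ∈ O := fun r => hf r ▸ hO _
  refine ⟨O, hφ, fun r => ?_⟩
  rw [← IsLocalization.AtPrime.to_map_mem_maximal_iff (Localization.AtPrime P) P r]
  have hm : (IsLocalRing.maximalIdeal O).comap (f.codRestrict O.toSubring hO) =
      IsLocalRing.maximalIdeal (Localization.AtPrime P) :=
    ((IsLocalRing.local_hom_TFAE (S := O) (f.codRestrict O.toSubring hO)).out 0 4).1 hl
  rw [← hm, Ideal.mem_comap]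
  have : φ r = ((⟨φ r, hφ r⟩ : O) : L) := rfl
  rw [this, ValuationSubring.coe_mem_nonunits_iff]
  have h2 : f.codRestrict O.toSubring hO (algebraMap R _ r) = ⟨φ r, hφ r⟩ := Subtype.ext (hf r)
  rw [h2]

/-- A chain of primes containing the kernel of a map to a field is dominated by a chain of primes
of a valuation ring. -/
theorem exists_valuationSubring_chain {R : Type*} [CommRing R] (l : List (Ideal R)) :
    ∀ {L : Type*} [Field L] (φ : R →+* L), l.Pairwise (· ≤ ·) → (∀ P ∈ l, P.IsPrime) →
    (∀ P ∈ l, RingHom.ker φ ≤ P) →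
    ∃ O : ValuationSubring L, (∀ r, φ r ∈ O) ∧
      ∀ P ∈ l, ∀ a ∈ P, ∀ c ∉ P, φ a / φ c ∈ O.nonunits := by
  induction l with
  | nil => exact fun φ _ _ _ => ⟨⊤, fun _ => ValuationSubring.mem_top _, by simp⟩
  | cons P l ih =>
    intro L _ φ hl hp hk
    rw [List.pairwise_cons] at hl
    have hP : P.IsPrime := hp P (by simp)
    obtain ⟨O, hO, hc⟩ := exists_valuationSubring_center φ P (hk P (by simp))
    -- Reduction has kernel exactly `P`, which lies in all later primes. The induction therefore
    -- continues with `ψ` and the residue field, and yields a place to compose with `O`.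
    let ψ : R →+* IsLocalRing.ResidueField O :=
      (IsLocalRing.residue O).comp (φ.codRestrict O.toSubring hO)
    have hψ : ∀ r, ψ r = IsLocalRing.residue O ⟨φ r, hO r⟩ := fun r => rfl
    have hker : RingHom.ker ψ = P := by
      ext r
      rw [RingHom.mem_ker, hψ, IsLocalRing.residue_eq_zero_iff, ← hc r,
        ← ValuationSubring.coe_mem_nonunits_iff]
    obtain ⟨O', hO', hc'⟩ := ih ψ hl.2 (fun Q hQ => hp Q (by simp [hQ]))
      (fun Q hQ => hker.le.trans (hl.1 Q hQ))
    have hinv : ∀ c ∉ P, φ c ≠ 0 ∧ (φ c)⁻¹ ∈ O := by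
      intro c hcP
      have h1 := mt (hc c).1 hcP
      rw [ValuationSubring.mem_nonunits_iff_or, not_or, not_not] at h1
      exact h1
    have hdiv : ∀ a c, c ∉ P → ∃ h : φ a / φ c ∈ O,
        IsLocalRing.residue O ⟨φ a / φ c, h⟩ = ψ a / ψ c := by
      intro a c hcP
      obtain ⟨h0, h1⟩ := hinv c hcP
      have h2 : φ a / φ c ∈ O := by rw [div_eq_mul_inv]; exact O.mul_mem _ _ (hO a) h1
      refine ⟨h2, ?_⟩
      have h3 : ψ c ≠ 0 := fun h => hcP (hker ▸ (RingHom.mem_ker.2 h))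
      rw [eq_div_iff h3, hψ, hψ, ← map_mul]
      congr 1
      exact Subtype.ext (div_mul_cancel₀ _ h0)
    refine ⟨compValuationSubring O O', fun r => mem_compValuationSubring.2 ⟨hO r, hO' r⟩, ?_⟩
    intro Q hQ a ha c hcQ
    -- A quotient with denominator outside `P` reduces to the quotient of the reductions. This is
    -- `0` for the first prime; for a later prime it is a nonunit of `O'` by induction.
    rcases List.mem_cons.1 hQ with rfl | hQ
    · obtain ⟨h1, h2⟩ := hdiv a c hcQ
      refine mem_nonunits_compValuationSubring h1 ?_
      rw [h2, RingHom.mem_ker.1 (hker.ge ha), zero_div]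
      exact zero_mem _
    · obtain ⟨h1, h2⟩ := hdiv a c fun h => hcQ (hl.1 Q hQ h)
      refine mem_nonunits_compValuationSubring h1 ?_
      rw [h2]
      exact hc' Q hQ a ha c hcQ

end Places

universe u

/-! ### From the valuation ring to an additive valuation -/

section ChainValuation

/-- A chain of primes of a domain is dominated by the chain of primes of a valuation, written
additively. -/
theorem exists_isValuation_of_chain {K : Type*} {A : Type u} [Field K] [CommRing A] [IsDomain A] [Algebra K A]
    (l : List (Ideal A)) (hl : l.Pairwise (· ≤ ·)) (hp : ∀ P ∈ l, P.IsPrime) :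
    ∃ (G : Type u) (_ : AddCommGroup G) (_ : LinearOrder G) (_ : IsOrderedAddMonoid G) (w : A → G),
      IsValuation K w ∧ ∀ P ∈ l, ∀ a ∈ P, ∀ c ∉ P, a ≠ 0 → w c < w a := by
  classical
  let φ := algebraMap A (FractionRing A)
  have hφ : Function.Injective φ := IsFractionRing.injective A (FractionRing A)
  obtain ⟨O, hO, hc⟩ := exists_valuationSubring_chain l φ hl hp fun P _ => by
    rw [(RingHom.injective_iff_ker_eq_bot φ).1 hφ]
    exact bot_le
  have h0 : ∀ a : A, a ≠ 0 → O.valuation (φ a) ≠ 0 := fun a ha =>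
    (Valuation.ne_zero_iff _).2 fun h => ha (hφ (h.trans (map_zero φ).symm))
  -- The multiplicative valuation is at most `1` on `O`; the order dual makes its nonunits positive.
  -- The value at `0` is arbitrary.
  let w : A → Additive (O.ValueGroupˣ)ᵒᵈ := fun a =>
    if h : a = 0 then 0 else Additive.ofMul (OrderDual.toDual (Units.mk0 _ (h0 a h)))
  have hw : ∀ (a : A) (h : a ≠ 0),
      w a = Additive.ofMul (OrderDual.toDual (Units.mk0 _ (h0 a h))) := fun a h => dif_neg h
  have hle : ∀ a b : A, a ≠ 0 → b ≠ 0 →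
      (w a ≤ w b ↔ O.valuation (φ b) ≤ O.valuation (φ a)) := by
    intro a b ha hb
    rw [hw a ha, hw b hb]
    rfl
  have heq : ∀ a b : A, a ≠ 0 → b ≠ 0 → O.valuation (φ a) = O.valuation (φ b) → w a = w b :=
    fun a b ha hb h => le_antisymm ((hle a b ha hb).2 h.ge) ((hle b a hb ha).2 h.le)
  refine ⟨_, inferInstance, inferInstance, inferInstance, w, ⟨?_, ?_, ?_⟩, ?_⟩
  · intro a b ha hb hab
    rw [min_le_iff, hle a _ ha hab, hle b _ hb hab, map_add]
    exact le_max_iff.1 (O.valuation.map_add _ _)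
  · intro c a hc0 ha
    have hca : c • a ≠ 0 := by
      intro h
      apply ha
      rw [← one_smul K a, ← inv_mul_cancel₀ hc0, mul_smul, h, smul_zero]
    refine heq _ _ hca ha ?_
    -- Nonzero constants lie in `O` together with their inverses, so they have value `1`.
    have h1 : ∀ k : K, O.valuation (φ (algebraMap K A k)) ≤ 1 := fun k =>
      (O.valuation_le_one_iff _).2 (hO _)
    have h2 : O.valuation (φ (algebraMap K A c)) * O.valuation (φ (algebraMap K A c⁻¹)) = 1 := by
      rw [← map_mul, ← map_mul, ← map_mul, mul_inv_cancel₀ hc0, map_one, map_one, map_one]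
    have h3 : O.valuation (φ (algebraMap K A c)) = 1 := by
      refine le_antisymm (h1 c) ?_
      calc 1 = _ := h2.symm
        _ ≤ O.valuation (φ (algebraMap K A c)) * 1 := by gcongr; exact h1 _
        _ = _ := mul_one _
    rw [Algebra.smul_def, map_mul, map_mul, h3, one_mul]
  · intro a b ha hb hab
    rw [hw a ha, hw b hb, hw _ hab, ← ofMul_mul, ← toDual_mul]
    congr 2
    exact Units.ext (by simp)
  · intro P hP a haP c hcP ha
    have hc0 : c ≠ 0 := fun h => hcP (h ▸ P.zero_mem)
    rw [← not_le, hle a c ha hc0, not_le]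
    have h1 := (O.mem_nonunits_iff).1 (hc P hP a haP c hcP)
    rw [map_div₀] at h1
    exact (div_lt_one₀ (zero_lt_iff.2 (h0 c hc0))).1 h1

end ChainValuation

/-! ### Valuations and linear independence -/

section Independence

variable {K A V : Type*} [Field K] [CommRing A] [Algebra K A] [AddCommGroup V]
    [LinearOrder V] [IsOrderedAddMonoid V] {w : A → V}

/-- Writing `y = (y + z) - z` shows that the sum cannot have a larger value than `y`. -/
theorem IsValuation.add_eq (hw : IsValuation K w) {y z : A} (hy : y ≠ 0) (hz : z ≠ 0)
    (h : w y < w z) : y + z ≠ 0 ∧ w (y + z) = w y := by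
  have hneg : w (-z) = w z := by
    have := hw.smul_eq (-1) z (by simp) hz
    simpa using this
  have hyz : y + z ≠ 0 := by
    intro h0
    rw [eq_neg_of_add_eq_zero_left h0, hneg] at h
    exact lt_irrefl _ h
  refine ⟨hyz, le_antisymm ?_ ?_⟩
  · have h1 := hw.min_le_add (y + z) (-z) hyz (neg_ne_zero.2 hz) (by simpa using hy)
    rw [add_neg_cancel_right, hneg] at h1
    rcases min_le_iff.1 h1 with h2 | h2
    · exact h2
    · exact absurd h (not_lt.2 h2)
  · have h1 := hw.min_le_add y z hy hz hyz
    rwa [min_eq_left h.le] at h1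

/-- Recording that the value of the sum is attained by a summand keeps it different from the value
of the next summand, so `IsValuation.add_eq` applies at each stage. -/
theorem IsValuation.sum_ne_zero (hw : IsValuation K w) {ι : Type*} (f : ι → A) (s : Finset ι)
    (hs : s.Nonempty) (h0 : ∀ i ∈ s, f i ≠ 0) (hinj : Set.InjOn (fun i => w (f i)) s) :
    ∑ i ∈ s, f i ≠ 0 ∧ ∃ i ∈ s, w (∑ i ∈ s, f i) = w (f i) := by
  classical
  induction hs using Finset.Nonempty.cons_induction with
  | singleton a => simpa using h0 a
  | cons a s ha hs ih =>
    obtain ⟨h1, i, hi, h2⟩ := ih (fun i hi => h0 i (by simp [hi])) (hinj.mono (by simp))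
    rw [Finset.sum_cons]
    have ha0 := h0 a (by simp)
    have hne : w (f a) ≠ w (∑ i ∈ s, f i) := by
      rw [h2]
      intro h
      have : a = i := hinj (by simp) (by simp [hi]) h
      exact ha (this ▸ hi)
    rcases lt_or_gt_of_ne hne with h | h
    · obtain ⟨h3, h4⟩ := hw.add_eq ha0 h1 h
      exact ⟨h3, a, by simp, h4⟩
    · obtain ⟨h3, h4⟩ := hw.add_eq h1 ha0 h
      rw [add_comm]
      exact ⟨h3, i, by simp [hi], h4.trans h2⟩

/-- Elements with distinct values are linearly independent. -/
theorem IsValuation.linearIndependent (hw : IsValuation K w) {ι : Type*} (f : ι → A)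
    (h0 : ∀ i, f i ≠ 0) (hinj : Function.Injective fun i => w (f i)) :
    LinearIndependent K f := by
  classical
  rw [linearIndependent_iff']
  intro s g hg i hi
  by_contra hgi
  have h1 : ∀ i ∈ s.filter (g · ≠ 0), g i • f i ≠ 0 := by
    intro j hj h
    have hj0 : g j ≠ 0 := (Finset.mem_filter.1 hj).2
    apply h0 j
    rw [← one_smul K (f j), ← inv_mul_cancel₀ hj0, mul_smul, h, smul_zero]
  refine (hw.sum_ne_zero (fun i => g i • f i) (s.filter (g · ≠ 0))
    ⟨i, Finset.mem_filter.2 ⟨hi, hgi⟩⟩ h1 ?_).1 ?_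
  · intro j hj k hk hjk
    simp only [Finset.coe_filter, Set.mem_ofPred_eq] at hj hk
    apply hinj
    simpa [hw.smul_eq _ _ hj.2 (h0 _), hw.smul_eq _ _ hk.2 (h0 _)] using hjk
  · rw [← hg]
    refine Finset.sum_subset (Finset.filter_subset _ _) fun j hj hj' => ?_
    have : g j = 0 := by
      by_contra h
      exact hj' (Finset.mem_filter.2 ⟨hj, h⟩)
    rw [this, zero_smul]

theorem IsValuation.map_one [Nontrivial A] (hw : IsValuation K w) : w 1 = 0 := by
  have := hw.mul_eq 1 1 one_ne_zero one_ne_zero (by simp)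
  rw [mul_one] at this
  exact left_eq_add.1 this

theorem IsValuation.map_pow [IsDomain A] (hw : IsValuation K w) {a : A} (ha : a ≠ 0) (n : ℕ) :
    w (a ^ n) = n • w a := by
  induction n with
  | zero => simp [hw.map_one]
  | succ n ih =>
    rw [pow_succ, hw.mul_eq _ _ (pow_ne_zero _ ha) ha (mul_ne_zero (pow_ne_zero _ ha) ha), ih,
      succ_nsmul]

theorem IsValuation.map_prod [IsDomain A] (hw : IsValuation K w) {ι : Type*} (s : Finset ι)
    (f : ι → A) (h0 : ∀ i, f i ≠ 0) : w (∏ i ∈ s, f i) = ∑ i ∈ s, w (f i) := by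
  classical
  induction s using Finset.induction_on with
  | empty => simp [hw.map_one]
  | insert a s ha ih =>
    have h1 : ∏ i ∈ s, f i ≠ 0 := Finset.prod_ne_zero_iff.2 fun i _ => h0 i
    rw [Finset.prod_insert ha, Finset.sum_insert ha, hw.mul_eq _ _ (h0 a) h1
      (mul_ne_zero (h0 a) h1), ih]

end Independence

/-! ### Rational coordinates of values along a flag -/

section Coordinates

variable {S : Type*} [PartialOrder S] {C : Flag S} {G : Type*} [AddCommGroup G]

/-- `q` is the vector of rational coordinates of `u` with respect to the family `g`. -/
def HasCoordinates [Fintype C] (g : C → G) (u : G) (q : ChainSpace C) : Prop :=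
  ∃ (d : ℕ) (e : C → ℤ), 0 < d ∧ d • u = ∑ i, e i • g i ∧ ∀ i, (d : ℚ) * ofColex q i = e i

variable [Fintype C]

theorem HasCoordinates.add {g : C → G} {u u' : G} {q q' : ChainSpace C}
    (h : HasCoordinates g u q) (h' : HasCoordinates g u' q') :
    HasCoordinates g (u + u') (q + q') := by
  obtain ⟨d, e, hd, h1, h2⟩ := h
  obtain ⟨d', e', hd', h1', h2'⟩ := h'
  refine ⟨d * d', fun i => d' * e i + d * e' i, Nat.mul_pos hd hd', ?_, fun i => ?_⟩
  · simp_rw [add_zsmul, Finset.sum_add_distrib, mul_smul,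
      ← Finset.smul_sum, ← h1, ← h1', natCast_zsmul, ← mul_nsmul', nsmul_add]
    rw [mul_comm d' d]
  · have h3 : ofColex (q + q') i = ofColex q i + ofColex q' i := rfl
    rw [h3]
    push_cast
    rw [← h2, ← h2']
    ring

theorem hasCoordinates_zero (g : C → G) : HasCoordinates g 0 (0 : ChainSpace C) :=
  ⟨1, 0, one_pos, by simp, fun i => by
    have : ofColex (0 : ChainSpace C) i = 0 := rfl
    simp [this]⟩

theorem hasCoordinates_chainVec (g : C → G) (i : C) : HasCoordinates g (g i) (chainVec i) := by
  classical
  refine ⟨1, fun j => if j = i then 1 else 0, one_pos, by simp [ite_smul], fun j => ?_⟩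
  simp [chainVec]

/-- An integral dependence relation between `u` and the family `g` determines coordinates. -/
theorem exists_hasCoordinates {g : C → G} {u : G} {k : ℤ} (hk : k ≠ 0) (e : C → ℤ)
    (h : k • u = ∑ i, e i • g i) : ∃ q, HasCoordinates g u q := by
  -- The denominator must be a positive natural number, so the sign of `k` moves to the
  -- coefficients.
  refine ⟨toColex fun i => (k.sign * e i : ℤ) / (k.natAbs : ℚ), k.natAbs, fun i => k.sign * e i,
    Int.natAbs_pos.2 hk, ?_, fun i => ?_⟩
  · simp_rw [mul_smul]
    rw [← Finset.smul_sum, ← h, ← natCast_zsmul, ← mul_zsmul, Int.sign_mul_self_eq_natAbs]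
  · have : (k.natAbs : ℚ) ≠ 0 := by exact_mod_cast Int.natAbs_ne_zero.2 hk
    rw [ofColex_toColex]
    field_simp

variable [LinearOrder G] [IsOrderedAddMonoid G]

/-- Integral combinations of elements infinitely smaller than `t` are smaller than `t`. -/
theorem abs_sum_zsmul_lt {ι : Type*} (s : Finset ι) (g : ι → G) (e : ι → ℤ) {t : G} (ht : 0 < t)
    (h : ∀ i ∈ s, ∀ m : ℕ, m • |g i| < t) : |∑ i ∈ s, e i • g i| < t := by
  -- The bound on all multiples, unlike the bound on the element alone, survives addition: `m • (|a|
  -- + |c|)` is at most `2m` times the larger of the two.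
  have key : ∀ m : ℕ, m • |∑ i ∈ s, e i • g i| < t := by
    refine Finset.sum_induction (fun i => e i • g i) (fun a => ∀ m : ℕ, m • |a| < t) ?_ ?_ ?_
    · intro a c ha hc m
      have h1 : m • |a + c| ≤ m • (|a| + |c|) := nsmul_le_nsmul_right (abs_add_le a c) m
      rcases le_total |a| |c| with h2 | h2
      · refine (h1.trans (nsmul_le_nsmul_right (add_le_add_left h2 _) m)).trans_lt ?_
        rw [← two_nsmul, ← mul_nsmul]
        exact hc _
      · refine (h1.trans (nsmul_le_nsmul_right (add_le_add_right h2 _) m)).trans_lt ?_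
        rw [← two_nsmul, ← mul_nsmul]
        exact ha _
    · simpa using ht
    · intro i hi m
      rw [abs_zsmul, ← natCast_zsmul, ← mul_zsmul, ← Int.natCast_natAbs, ← Nat.cast_mul,
        natCast_zsmul]
      exact h i hi _
  simpa using key 1

/-- An ordered group is torsion-free. This is what makes positivity of values strict on coordinates.
-/
theorem HasCoordinates.eq_zero {g : C → G} {u : G} (h : HasCoordinates g u 0) : u = 0 := by
  obtain ⟨d, e, hd, h1, h2⟩ := h
  have he : ∀ i, e i = 0 := fun i => by
    have h3 : ((e i : ℤ) : ℚ) = 0 := (h2 i).symm.trans (mul_zero _)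
    exact_mod_cast h3
  simp_rw [he, zero_zsmul, Finset.sum_const_zero] at h1
  exact (nsmul_eq_zero_iff.1 h1).resolve_right hd.ne'

variable [Fintype S]

/-- Coordinates with respect to a family in which each member is infinitely larger than the
previous ones reflect the reverse lexicographic order. -/
theorem HasCoordinates.lt {g : C → G} (hpos : ∀ i, 0 < g i)
    (hg : ∀ i j : C, i < j → ∀ m : ℕ, m • g i < g j) {u u' : G} {q q' : ChainSpace C}
    (h : HasCoordinates g u q) (h' : HasCoordinates g u' q') (hlt : q < q') : u < u' := by
  classical
  obtain ⟨d, e, hd, h1, h2⟩ := h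
  obtain ⟨d', e', hd', h1', h2'⟩ := h'
  obtain ⟨j, hj1, hj2⟩ := chainSpace_lt_iff.1 hlt
  have hdQ : (0 : ℚ) < d := by exact_mod_cast hd
  have hdQ' : (0 : ℚ) < d' := by exact_mod_cast hd'
  -- These are the coefficients of `(d * d') • (u' - u)`: zero above `j`, and a positive integer at
  -- `j`.
  have hE : ∀ i, (((d : ℤ) * e' i - d' * e i : ℤ) : ℚ) = d * d' * (ofColex q' i - ofColex q i) := by
    intro i
    push_cast
    rw [← h2, ← h2']
    ring
  have hE1 : ∀ i, j < i → (d : ℤ) * e' i - d' * e i = 0 := by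
    intro i hi
    have h3 : ofColex q i = ofColex q' i := hj1 i hi
    have := hE i
    rw [h3, sub_self, mul_zero] at this
    exact_mod_cast this
  have hE2 : 0 < (d : ℤ) * e' j - d' * e j := by
    have h3 : ofColex q j < ofColex q' j := hj2
    have h4 : (0 : ℚ) < (((d : ℤ) * e' j - d' * e j : ℤ) : ℚ) := by
      rw [hE j]
      exact mul_pos (mul_pos hdQ hdQ') (sub_pos.2 h3)
    exact_mod_cast h4
  have hsum : (d * d') • (u' - u) = ∑ i, ((d : ℤ) * e' i - d' * e i) • g i := by
    simp_rw [sub_smul, Finset.sum_sub_distrib, mul_smul,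
      ← Finset.smul_sum, ← h1, ← h1', natCast_zsmul, ← mul_nsmul', nsmul_sub]
    rw [mul_comm d' d]
  have hsplit : ∑ i, ((d : ℤ) * e' i - d' * e i) • g i =
      ((d : ℤ) * e' j - d' * e j) • g j +
        ∑ i ∈ Finset.univ.filter (· < j), ((d : ℤ) * e' i - d' * e i) • g i := by
    rw [← Finset.add_sum_erase _ _ (Finset.mem_univ j)]
    congr 1
    symm
    refine Finset.sum_subset (fun i hi => ?_) fun i hi hi' => ?_
    · exact Finset.mem_erase.2 ⟨(Finset.mem_filter.1 hi).2.ne, Finset.mem_univ _⟩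
    · rw [hE1 i, zero_zsmul]
      refine lt_of_le_of_ne (not_lt.1 fun h => hi' ?_) (Finset.mem_erase.1 hi).1.symm
      exact Finset.mem_filter.2 ⟨Finset.mem_univ _, h⟩
  have hsmall := abs_sum_zsmul_lt (Finset.univ.filter (· < j)) g
    (fun i => (d : ℤ) * e' i - d' * e i) (hpos j) fun i hi m => by
      rw [abs_of_pos (hpos i)]
      exact hg i j (Finset.mem_filter.1 hi).2 m
  -- The leading term is at least `g j`, while all lower terms together stay below `g j` in absolute
  -- value.
  have hbig : g j ≤ ((d : ℤ) * e' j - d' * e j) • g j := by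
    calc g j = (1 : ℤ) • g j := (one_zsmul _).symm
      _ ≤ _ := zsmul_le_zsmul_left (hpos j).le hE2
  have htot : 0 < (d * d') • (u' - u) := by
    rw [hsum, hsplit]
    have := (abs_lt.1 hsmall).1
    calc (0 : G) = g j + -g j := (add_neg_cancel _).symm
      _ < _ := add_lt_add_of_le_of_lt hbig this
  by_contra hcon
  exact absurd htot (not_lt.2 (nsmul_nonpos (sub_nonpos.2 (not_lt.1 hcon)) _))

theorem HasCoordinates.unique {g : C → G} (hpos : ∀ i, 0 < g i)
    (hg : ∀ i j : C, i < j → ∀ m : ℕ, m • g i < g j) {u : G} {q q' : ChainSpace C}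
    (h : HasCoordinates g u q) (h' : HasCoordinates g u q') : q = q' := by
  rcases lt_trichotomy q q' with h1 | h1 | h1
  · exact absurd (h.lt hpos hg h' h1) (lt_irrefl _)
  · exact h1
  · exact absurd (h'.lt hpos hg h h1) (lt_irrefl _)

theorem HasCoordinates.mono {g : C → G} (hpos : ∀ i, 0 < g i)
    (hg : ∀ i j : C, i < j → ∀ m : ℕ, m • g i < g j) {u u' : G} {q q' : ChainSpace C}
    (h : HasCoordinates g u q) (h' : HasCoordinates g u' q') (hle : u ≤ u') : q ≤ q' :=
  not_lt.1 fun h1 => absurd (h'.lt hpos hg h h1) (not_lt.2 hle)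

end Coordinates

/-! ### Bounded denominators of LS paths -/

section Bounds

variable {S : Type*} [PartialOrder S]

theorem bondGcd_pos {b : S → S → ℕ} (hb : ∀ σ τ, σ ⋖ τ → 0 < b σ τ) (l : List S)
    (hl : l.IsChain (· ⋖ ·)) (h2 : 2 ≤ l.length) : 0 < bondGcd b l := by
  match l, hl, h2 with
  | σ :: τ :: l, hl, _ =>
    rw [List.isChain_cons_cons] at hl
    exact Nat.gcd_pos_of_pos_left _ (hb σ τ hl.1)

theorem Bonds.ext_pos [Finite S] (b : Bonds S) {σ τ : S} (h : σ < τ) : 0 < b.ext σ τ := by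
  have hr : Relation.ReflTransGen (· ⋖ ·) σ τ := by
    induction σ using WellFoundedGT.induction with
    | ind σ ih =>
      obtain ⟨η, h1, h2⟩ := exists_covBy_le_of_lt h
      rcases eq_or_lt_of_le h2 with rfl | h2
      · exact Relation.ReflTransGen.single h1
      · exact Relation.ReflTransGen.head h1 (ih η h1.lt h2)
  obtain ⟨l, hl1, hl2⟩ := List.exists_isChain_cons_of_relationReflTransGen hr
  have hm : IsMaximalChainBetween σ τ (σ :: l) :=
    ⟨hl1, rfl, by rw [List.getLast?_eq_some_getLast (by simp), hl2]⟩
  rw [b.ext_eq hm]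
  -- A one-element chain has gcd `0`; it is excluded by `σ < τ`.
  refine bondGcd_pos b.bond_pos _ hl1 ?_
  cases l with
  | nil =>
    simp only [List.getLast_singleton] at hl2
    exact absurd hl2 h.ne
  | cons η l => simp

variable [Fintype S]

/-- A common denominator for the values of all LS paths. -/
noncomputable def bondDenominator (b : Bonds S) : ℕ :=
  ∏ p : S × S, max 1 (b.ext p.1 p.2)

theorem bondDenominator_pos (b : Bonds S) : 0 < bondDenominator b :=
  Finset.prod_pos fun _ _ => lt_max_of_lt_left one_pos

/-- The truncation `max 1` only guards against pairs whose extended bond is `0`; for `σ < τ` the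
bond itself is a factor. -/
theorem Bonds.ext_dvd (b : Bonds S) {σ τ : S} (h : σ < τ) : b.ext σ τ ∣ bondDenominator b := by
  have h1 : max 1 (b.ext (σ, τ).1 (σ, τ).2) ∣ bondDenominator b :=
    Finset.dvd_prod_of_mem (fun p : S × S => max 1 (b.ext p.1 p.2)) (Finset.mem_univ (σ, τ))
  rwa [max_eq_right (b.ext_pos h : 1 ≤ _)] at h1

/-- If `σ` has a successor in the support, the bond of that pair clears the denominator; otherwise
the partial sum is the whole degree. -/
theorem IsLSPath.integral_partialSum {b : Bonds S} {r : ℕ} {π : S → ℚ} (hπ : IsLSPath b r π)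
    {σ : S} (hσ : π σ ≠ 0) : ∃ n : ℤ, (bondDenominator b : ℚ) * partialSum π σ = n := by
  classical
  by_cases hmax : ∃ τ, π τ ≠ 0 ∧ σ < τ
  · obtain ⟨τ, hτ⟩ := (Finset.univ.filter fun τ => π τ ≠ 0 ∧ σ < τ).exists_minimal
      (by obtain ⟨τ, hτ⟩ := hmax; exact ⟨τ, by simpa using hτ⟩)
    have hτ1 := (Finset.mem_filter.1 hτ.1).2
    obtain ⟨n, hn⟩ := hπ.integral σ hσ τ hτ1.1 hτ1.2 fun η hη h =>
      absurd (hτ.2 (Finset.mem_filter.2 ⟨Finset.mem_univ η, hη, h.1⟩) h.2.le) (not_le_of_gt h.2)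
    obtain ⟨k, hk⟩ := b.ext_dvd hτ1.2
    refine ⟨n * k, ?_⟩
    rw [hk]
    push_cast
    rw [← hn]
    ring
  · push Not at hmax
    refine ⟨bondDenominator b * r, ?_⟩
    have : partialSum π σ = r := by
      rw [← hπ.sum_eq]
      refine Finset.sum_subset (Finset.subset_univ _) fun η _ hη => ?_
      by_contra h
      rcases hπ.isChain.total (show σ ∈ Function.support π from hσ) h with h1 | h1
      · rcases eq_or_lt_of_le h1 with rfl | h1
        · exact hη (by simp)
        · exact hmax η h h1
      · exact hη (by simpa using h1)
    rw [this]
    push_cast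
    rfl

/-- The witness is the largest support element below `σ`; this reduces strict sums to partial sums
at the support, where integrality is known. -/
theorem IsLSPath.strictPartialSum_eq {b : Bonds S} {r : ℕ} {π : S → ℚ} (hπ : IsLSPath b r π)
    (σ : S) :
    strictPartialSum π σ = 0 ∨ ∃ τ, π τ ≠ 0 ∧ strictPartialSum π σ = partialSum π τ := by
  classical
  by_cases hmin : ∃ τ, π τ ≠ 0 ∧ τ < σ
  · right
    obtain ⟨τ, hτ⟩ := (Finset.univ.filter fun τ => π τ ≠ 0 ∧ τ < σ).exists_maximal
      (by obtain ⟨τ, hτ⟩ := hmin; exact ⟨τ, by simpa using hτ⟩)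
    have hτ1 := (Finset.mem_filter.1 hτ.1).2
    refine ⟨τ, hτ1.1, ?_⟩
    symm
    refine Finset.sum_subset (fun η hη => ?_) fun η hη hη' => ?_
    · simp only [Finset.mem_filter, Finset.mem_univ, true_and] at hη ⊢
      exact hη.trans_lt hτ1.2
    · simp only [Finset.mem_filter, Finset.mem_univ, true_and] at hη hη'
      by_contra h
      rcases hπ.isChain.total (show τ ∈ Function.support π from hτ1.1) h with h1 | h1
      · exact hη' (hτ.2 (Finset.mem_filter.2 ⟨Finset.mem_univ η, h, hη⟩) h1)
      · exact hη' h1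
  · left
    push Not at hmin
    refine Finset.sum_eq_zero fun η hη => ?_
    by_contra h
    exact hmin η h (Finset.mem_filter.1 hη).2

/-- A value is the difference of two partial sums with a common denominator, and the degree bounds
it. -/
theorem IsLSPath.integral_apply {b : Bonds S} {r : ℕ} {π : S → ℚ} (hπ : IsLSPath b r π)
    (σ : S) : ∃ n : ℕ, n ≤ bondDenominator b * r ∧ (bondDenominator b : ℚ) * π σ = n := by
  classical
  have hZ : ∃ n : ℤ, (bondDenominator b : ℚ) * π σ = n := by
    by_cases hσ : π σ = 0
    · exact ⟨0, by simp [hσ]⟩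
    obtain ⟨n, hn⟩ := hπ.integral_partialSum hσ
    have hm : ∃ m : ℤ, (bondDenominator b : ℚ) * strictPartialSum π σ = m := by
      rcases hπ.strictPartialSum_eq σ with h | ⟨τ, hτ, h⟩
      · exact ⟨0, by simp [h]⟩
      · rw [h]
        exact hπ.integral_partialSum hτ
    obtain ⟨m, hm⟩ := hm
    refine ⟨n - m, ?_⟩
    rw [partialSum_eq, mul_add, hm] at hn
    push_cast
    linarith
  obtain ⟨n, hn⟩ := hZ
  have hM : (0 : ℚ) ≤ bondDenominator b := by positivity
  have h0 : 0 ≤ n := by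
    have : (0 : ℚ) ≤ n := hn ▸ mul_nonneg hM (hπ.nonneg σ)
    exact_mod_cast this
  lift n to ℕ using h0
  refine ⟨n, ?_, by exact_mod_cast hn⟩
  have hle : π σ ≤ r := by
    rw [← hπ.sum_eq]
    exact Finset.single_le_sum (fun η _ => hπ.nonneg η) (Finset.mem_univ σ)
  have h1 : ((n : ℕ) : ℚ) ≤ (bondDenominator b * r : ℕ) := by
    push_cast
    have h2 : (bondDenominator b : ℚ) * π σ = (n : ℚ) := by exact_mod_cast hn
    rw [← h2]
    exact mul_le_mul_of_nonneg_left hle hM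
  exact_mod_cast h1

end Bounds

/-! ### Grades along a maximal chain -/

section Grade

variable {S : Type*} [PartialOrder S]

/-- A cover within a maximal chain is a cover in `S` and raises the grade by one, so the chain meets
every grade from `0` to that of `⊤`. Thus the exponent of growth is at most the size of the flag. -/
theorem exists_strictMono_fin_flag [Finite S] [BoundedOrder S] [GradeMinOrder ℕ S] (C : Flag S) [Fintype C] :
    ∃ (n : ℕ) (gr : S → Fin n), StrictMono gr ∧ n ≤ Fintype.card C := by
  have hle : ∀ σ : S, grade ℕ σ < grade ℕ (⊤ : S) + 1 := fun σ =>
    Nat.lt_succ_of_le ((grade_strictMono (𝕆 := ℕ)).monotone le_top)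
  refine ⟨grade ℕ (⊤ : S) + 1, fun σ => ⟨grade ℕ σ, hle σ⟩,
    fun σ τ h => (grade_strictMono (𝕆 := ℕ)) h, ?_⟩
  have hsurj : ∀ i : ℕ, i < grade ℕ (⊤ : S) + 1 → ∃ σ : C, grade ℕ (σ : S) = i := by
    intro i
    induction i with
    | zero =>
      intro _
      refine ⟨⊥, ?_⟩
      simp
    | succ i ih =>
      intro hi
      obtain ⟨σ, hσ⟩ := ih (by omega)
      have hnm : ¬ IsMax σ := by
        intro hm
        have : (σ : S) = ⊤ := (Flag.isMax_coe.2 hm).eq_top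
        rw [this] at hσ
        omega
      obtain ⟨τ, hτ⟩ := exists_covBy_of_wellFoundedLT hnm
      refine ⟨τ, ?_⟩
      have h1 := (Flag.coe_covBy_coe.2 hτ).grade ℕ
      rw [Nat.covBy_iff_add_one_eq] at h1
      omega
  have : Function.Surjective fun σ : C =>
      (⟨grade ℕ (σ : S), hle σ⟩ : Fin (grade ℕ (⊤ : S) + 1)) := fun i => by
    obtain ⟨σ, hσ⟩ := hsurj i i.2
    exact ⟨σ, Fin.ext hσ⟩
  simpa using Fintype.card_le_of_surjective _ this

end Grade

/-! ### Encoding LS paths of bounded degree -/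

section Count

variable {S : Type*} [PartialOrder S] [Fintype S]

/-- The value of an LS path of degree at most `r` at `σ`, multiplied by the common denominator. -/
noncomputable def scaledValue {b : Bonds S} {r : ℕ} (π : {π : LSPath b // π.degree ≤ r}) (σ : S) :
    Fin (bondDenominator b * r + 1) :=
  ⟨(π.1.isLSPath.integral_apply σ).choose, Nat.lt_succ_of_le
    ((π.1.isLSPath.integral_apply σ).choose_spec.1.trans (Nat.mul_le_mul_left _ π.2))⟩

theorem scaledValue_spec {b : Bonds S} {r : ℕ} (π : {π : LSPath b // π.degree ≤ r}) (σ : S) :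
    (bondDenominator b : ℚ) * π.1.toFun σ = (scaledValue π σ : ℕ) :=
  (π.1.isLSPath.integral_apply σ).choose_spec.2

open scoped Classical in
/-- An LS path is determined by its support and by its values, listed by the grades of the
elements of the support. -/
noncomputable def pathCode {b : Bonds S} {n r : ℕ} (gr : S → Fin n)
    (π : {π : LSPath b // π.degree ≤ r}) :
    Finset S × (Fin n → Fin (bondDenominator b * r + 1)) :=
  (Finset.univ.filter fun σ => π.1.toFun σ ≠ 0, fun i =>
    if h : ∃ σ, gr σ = i ∧ π.1.toFun σ ≠ 0 then scaledValue π h.choose else 0)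

/-- A chain meets each grade at most once, so support and grade recover the element carrying a
value. Listing values by grade makes the exponent of `r` equal to `n`; the choice of support costs
only a constant factor. -/
theorem pathCode_injective {b : Bonds S} {n r : ℕ} {gr : S → Fin n} (hgr : StrictMono gr) :
    Function.Injective (pathCode (b := b) (r := r) gr) := by
  classical
  intro π π' h
  have hM : (bondDenominator b : ℚ) ≠ 0 := by exact_mod_cast (bondDenominator_pos b).ne'
  have hval : ∀ (π : {π : LSPath b // π.degree ≤ r}) (σ : S), π.1.toFun σ ≠ 0 →
      (pathCode gr π).2 (gr σ) = scaledValue π σ := by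
    intro π σ hσ
    have hex : ∃ τ, gr τ = gr σ ∧ π.1.toFun τ ≠ 0 := ⟨σ, rfl, hσ⟩
    have h1 : (pathCode gr π).2 (gr σ) = scaledValue π hex.choose := dif_pos hex
    rw [h1]
    congr 1
    by_contra hne
    rcases π.1.isLSPath.isChain hex.choose_spec.2 hσ hne with h2 | h2
    · exact (hgr (lt_of_le_of_ne h2 hne)).ne hex.choose_spec.1
    · exact (hgr (lt_of_le_of_ne h2 (Ne.symm hne))).ne hex.choose_spec.1.symm
  have hsupp : ∀ σ, π.1.toFun σ ≠ 0 ↔ π'.1.toFun σ ≠ 0 := by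
    intro σ
    have := congrArg (fun p => σ ∈ p.1) h
    simpa [pathCode] using this
  refine Subtype.ext (LSPath.ext_toFun (funext fun σ => ?_))
  by_cases hσ : π.1.toFun σ = 0
  · rw [hσ]
    by_contra h0
    exact (hsupp σ).2 (Ne.symm h0) hσ
  · apply mul_left_cancel₀ hM
    rw [scaledValue_spec, scaledValue_spec, ← hval π σ hσ, ← hval π' σ ((hsupp σ).1 hσ), h]

end Count

/-! ### Path ideals and the irrelevant ideal -/

section Paths

variable {S : Type*} [PartialOrder S] [Fintype S] {b : Bonds S}

theorem sum_sum_map_toFun (l : List (LSPathOne b)) :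
    ∑ σ, (l.map fun π' => π'.1.toFun).sum σ = l.length := by
  induction l with
  | nil => simp
  | cons π l ih =>
    have h1 : ∑ σ, π.1.toFun σ = 1 := by
      rw [π.1.isLSPath.sum_eq, π.2, Nat.cast_one]
    simp only [List.map_cons, List.sum_cons, Pi.add_apply, Finset.sum_add_distrib, ih, h1,
      List.length_cons]
    push_cast
    ring

theorem canonicalForm_sum (π : LSPath b) :
    ((canonicalForm π).map fun π' => π'.1.toFun).sum = π.toFun :=
  (exists_isCanonicalForm π).choose_spec.2

theorem length_canonicalForm (π : LSPath b) : (canonicalForm π).length = π.degree := by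
  have h := sum_sum_map_toFun (canonicalForm π)
  rw [canonicalForm_sum, π.isLSPath.sum_eq] at h
  exact_mod_cast h.symm

variable {A : Type*} [CommRing A]

theorem pathElem_of_degree_eq_zero (x : LSPathOne b → A) {π : LSPath b} (h : π.degree = 0) :
    pathElem x π = 1 := by
  rw [pathElem, List.eq_nil_of_length_eq_zero ((length_canonicalForm π).trans h)]
  simp

theorem pathElem_coe (x : LSPathOne b → A) (π : LSPathOne b) : pathElem x π.1 = x π := by
  obtain ⟨ρ, hρ⟩ := List.length_eq_one_iff.1 ((length_canonicalForm π.1).trans π.2)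
  have h := canonicalForm_sum π.1
  rw [hρ] at h
  have h1 : ρ = π := Subtype.ext (LSPath.ext_toFun (by simpa using h))
  rw [pathElem, hρ, h1]
  simp

theorem extremal_mem_pathIdeal (x : LSPathOne b → A) {σ τ : S} (h : ¬ σ ≤ τ) :
    x (extremalOne b σ) ∈ pathIdeal x τ := by
  rw [← pathElem_coe x]
  refine Ideal.subset_span ⟨_, ⟨σ, ?_, h⟩, rfl⟩
  simp [extremalOne, extremal, extremalFun]

theorem pathIdeal_anti (x : LSPathOne b → A) {σ τ : S} (h : σ ≤ τ) :
    pathIdeal x τ ≤ pathIdeal x σ :=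
  Ideal.span_mono (Set.image_mono fun _ ⟨η, hη, hη'⟩ => ⟨η, hη, fun h' => hη' (h'.trans h)⟩)

theorem pathIdeal_top [OrderTop S] (x : LSPathOne b → A) : pathIdeal x ⊤ = ⊥ := by
  have : {π : LSPath b | ∃ σ ∈ Function.support π.toFun, ¬ σ ≤ (⊤ : S)} = ∅ := by
    ext π
    simp
  rw [pathIdeal, this, Set.image_empty, Ideal.span_empty]

/-- The ideal generated by the LS paths of positive degree. -/
noncomputable def irrelevantIdeal (x : LSPathOne b → A) : Ideal A :=
  Ideal.span (pathElem x '' {π | 0 < π.degree})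

theorem degree_pos_of_apply_ne_zero {π : LSPath b} {σ : S} (h : π.toFun σ ≠ 0) :
    0 < π.degree := by
  have h1 : π.toFun σ ≤ π.degree := by
    rw [← π.isLSPath.sum_eq]
    exact Finset.single_le_sum (fun η _ => π.isLSPath.nonneg η) (Finset.mem_univ σ)
  have h2 : 0 < π.toFun σ := lt_of_le_of_ne (π.isLSPath.nonneg σ) (Ne.symm h)
  exact_mod_cast h2.trans_le h1

theorem pathIdeal_le_irrelevantIdeal (x : LSPathOne b → A) (τ : S) :
    pathIdeal x τ ≤ irrelevantIdeal x :=
  Ideal.span_mono (Set.image_mono fun _ ⟨_, hη, _⟩ => degree_pos_of_apply_ne_zero hη)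

end Paths

/-! ### Consequences of the grading and the basis of LS paths -/

section Graded

variable {S : Type*} [PartialOrder S] [Fintype S] {b : Bonds S} {K A : Type*} [Field K]
  [CommRing A] [Algebra K A] {x : LSPathOne b → A}

variable (K x) in
/-- The subspace spanned by a set of LS paths. -/
noncomputable def pathSpan (T : Set (LSPath b)) : Submodule K A :=
  Submodule.span K (pathElem x '' T)

theorem pathSpan_mono {T T' : Set (LSPath b)} (h : T ⊆ T') : pathSpan K x T ≤ pathSpan K x T' :=
  Submodule.span_mono (Set.image_mono h)

theorem pathElem_mem_pathSpan {T : Set (LSPath b)} {π : LSPath b} (h : π ∈ T) :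
    pathElem x π ∈ pathSpan K x T :=
  Submodule.subset_span ⟨π, h, rfl⟩

theorem mul_mem_pathSpan {T T' T'' : Set (LSPath b)}
    (h : ∀ π ∈ T, ∀ π' ∈ T', pathElem x π * pathElem x π' ∈ pathSpan K x T'') {a c : A}
    (ha : a ∈ pathSpan K x T) (hc : c ∈ pathSpan K x T') : a * c ∈ pathSpan K x T'' := by
  refine (Submodule.mul_le (M := pathSpan K x T) (N := pathSpan K x T')).1 ?_ a ha c hc
  unfold pathSpan
  rw [Submodule.span_mul_span, Submodule.span_le]
  rintro _ ⟨_, ⟨π, hπ, rfl⟩, _, ⟨π', hπ', rfl⟩, rfl⟩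
  exact h π hπ π' hπ'

theorem IsLSAlgebra.pathElem_mul_mem (hA : IsLSAlgebra K b x) (π π' : LSPath b) :
    pathElem x π * pathElem x π' ∈
      pathSpan K x {ρ | ρ.degree = π.degree + π'.degree} :=
  hA.graded.toGradedMul.mul_mem (pathElem_mem_pathSpan (T := {ρ | ρ.degree = π.degree}) rfl)
    (pathElem_mem_pathSpan (T := {ρ | ρ.degree = π'.degree}) rfl)

theorem IsLSAlgebra.pathSpan_univ (hA : IsLSAlgebra K b x) : pathSpan K x Set.univ = ⊤ := by
  rw [pathSpan, Set.image_univ, hA.span_eq_top]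

/-- The ideal generated by LS paths of positive degree contains no LS paths of degree `1` apart
from its generators. -/
theorem IsLSAlgebra.ideal_span_subset (hA : IsLSAlgebra K b x) {T : Set (LSPath b)}
    (hT : ∀ π ∈ T, 0 < π.degree) {a : A} (ha : a ∈ Ideal.span (pathElem x '' T)) :
    a ∈ pathSpan K x {π | 1 < π.degree ∨ π ∈ T} := by
  refine Submodule.span_induction ?_ (zero_mem _) (fun _ _ _ _ => add_mem) ?_ ha
  · rintro _ ⟨π, hπ, rfl⟩
    exact pathElem_mem_pathSpan (Or.inr hπ)
  · intro c y _ hy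
    have hc : c ∈ pathSpan K x Set.univ := hA.pathSpan_univ ▸ Submodule.mem_top
    refine mul_mem_pathSpan (fun π _ π' hπ' => ?_) hc hy
    -- A path of degree `0` acts as `1`; any other raises the positive degree of `π'` above `1`.
    rcases Nat.eq_zero_or_pos π.degree with h0 | h0
    · rw [pathElem_of_degree_eq_zero x h0, one_mul]
      exact pathElem_mem_pathSpan hπ'
    · refine pathSpan_mono (fun ρ hρ => Or.inl ?_) (hA.pathElem_mul_mem π π')
      have h1 : 0 < π'.degree := hπ'.elim (fun h => by omega) (hT _)
      have h2 : ρ.degree = π.degree + π'.degree := hρ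
      omega

theorem IsLSAlgebra.pathElem_mem_iff (hA : IsLSAlgebra K b x) {T : Set (LSPath b)}
    {π : LSPath b} : pathElem x π ∈ pathSpan K x T ↔ π ∈ T :=
  ⟨fun h => by_contra fun h' => hA.linearIndependent.notMem_span_image h' h,
    pathElem_mem_pathSpan⟩

/-- Having degree `1`, this basis element could only lie in the ideal as one of its generators, but
its support is `{τ}`. -/
theorem IsLSAlgebra.extremal_notMem_pathIdeal (hA : IsLSAlgebra K b x) (τ : S) :
    x (extremalOne b τ) ∉ pathIdeal x τ := by
  classical
  intro h
  have h1 := hA.ideal_span_subset (T := {π | ∃ σ ∈ Function.support π.toFun, ¬ σ ≤ τ})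
    (fun π ⟨η, hη, _⟩ => degree_pos_of_apply_ne_zero hη) h
  rw [← pathElem_coe x, hA.pathElem_mem_iff] at h1
  rcases h1 with h1 | ⟨η, hη, h1⟩
  · exact absurd h1 (by simp [extremalOne, extremal])
  · apply h1
    by_contra h2
    apply hη
    have : η ≠ τ := fun h3 => h2 h3.le
    simp [extremalOne, extremal, extremalFun, this]

/-- The unit is the basis element of degree `0`, hence independent of all paths of positive degree.
-/
theorem IsLSAlgebra.irrelevantIdeal_ne_top [Nonempty S] (hA : IsLSAlgebra K b x) :
    irrelevantIdeal x ≠ ⊤ := by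
  intro h
  have h1 : (1 : A) ∈ irrelevantIdeal x := h ▸ Submodule.mem_top
  have h2 := hA.ideal_span_subset (fun π hπ => hπ) h1
  have hd : (extremal b 0 (Classical.arbitrary S)).degree = 0 := rfl
  rw [← pathElem_of_degree_eq_zero x hd, hA.pathElem_mem_iff] at h2
  have h3 : 0 < (extremal b 0 (Classical.arbitrary S)).degree :=
    h2.elim (fun h => zero_lt_one.trans h) id
  exact absurd h3 (by simp [hd])

theorem degreePart_le_irrelevantIdeal {r : ℕ} (hr : r ≠ 0) {a : A} (ha : a ∈ degreePart K x r) :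
    a ∈ irrelevantIdeal x := by
  have h : degreePart K x r ≤ (irrelevantIdeal x).restrictScalars K := by
    refine Submodule.span_le.2 ?_
    rintro _ ⟨π, hπ, rfl⟩
    refine Ideal.subset_span ⟨π, ?_, rfl⟩
    have : π.degree = r := hπ
    simp only [Set.mem_ofPred_eq]
    omega
  exact h ha

/-- Degree `0` consists of scalars, so positivity only concerns positive degrees. -/
theorem isUnit_of_mem_degreePart_zero {a : A} (ha : a ∈ degreePart K x 0) (h0 : a ≠ 0) :
    IsUnit a := by
  have h : degreePart K x 0 ≤ Submodule.span K {1} := by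
    refine Submodule.span_le.2 ?_
    rintro _ ⟨π, hπ, rfl⟩
    rw [pathElem_of_degree_eq_zero x hπ]
    exact Submodule.subset_span rfl
  obtain ⟨c, rfl⟩ := Submodule.mem_span_singleton.1 (h ha)
  have hc : c ≠ 0 := by
    rintro rfl
    simp at h0
  rw [Algebra.smul_def, mul_one]
  exact (isUnit_iff_ne_zero.2 hc).map (algebraMap K A)

end Graded

/-! ### Polynomial growth and coincidences of values -/

section Growth

variable {S : Type*} [PartialOrder S] [Fintype S] {b : Bonds S} {K A : Type*} [Field K]
  [CommRing A] [Algebra K A] {x : LSPathOne b → A}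

variable (K x) in
/-- The subspace spanned by the LS paths of degree at most `r`. -/
noncomputable def degreeLE (r : ℕ) : Submodule K A := pathSpan K x {π | π.degree ≤ r}

theorem degreeLE_mono {r s : ℕ} (h : r ≤ s) : degreeLE K x r ≤ degreeLE K x s :=
  pathSpan_mono fun _ hπ => le_trans hπ h

theorem IsLSAlgebra.mul_mem_degreeLE (hA : IsLSAlgebra K b x) {r s : ℕ} {a c : A}
    (ha : a ∈ degreeLE K x r) (hc : c ∈ degreeLE K x s) : a * c ∈ degreeLE K x (r + s) := by
  refine mul_mem_pathSpan (fun π hπ π' hπ' => ?_) ha hc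
  refine pathSpan_mono (fun ρ hρ => ?_) (hA.pathElem_mul_mem π π')
  have h1 : ρ.degree = π.degree + π'.degree := hρ
  have h2 : π.degree ≤ r := hπ
  have h3 : π'.degree ≤ s := hπ'
  simp only [Set.mem_ofPred_eq]
  omega

theorem IsLSAlgebra.one_mem_degreeLE (hA : IsLSAlgebra K b x) : (1 : A) ∈ degreeLE K x 0 := by
  have h : (1 : A) ∈ degreePart K x 0 := hA.graded.toGradedOne.one_mem
  exact pathSpan_mono (T := {π | π.degree = 0}) (fun _ hπ => le_of_eq hπ) h

theorem IsLSAlgebra.pow_mem_degreeLE (hA : IsLSAlgebra K b x) {r : ℕ} {a : A}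
    (ha : a ∈ degreeLE K x r) (n : ℕ) : a ^ n ∈ degreeLE K x (n * r) := by
  induction n with
  | zero => simpa using hA.one_mem_degreeLE
  | succ n ih =>
    rw [pow_succ, Nat.succ_mul]
    exact hA.mul_mem_degreeLE ih ha

theorem IsLSAlgebra.prod_mem_degreeLE (hA : IsLSAlgebra K b x) {ι : Type*} (s : Finset ι)
    (f : ι → A) (r : ι → ℕ) (h : ∀ i, f i ∈ degreeLE K x (r i)) :
    ∏ i ∈ s, f i ∈ degreeLE K x (∑ i ∈ s, r i) := by
  classical
  induction s using Finset.induction_on with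
  | empty => simpa using hA.one_mem_degreeLE
  | insert i s hi ih =>
    rw [Finset.prod_insert hi, Finset.sum_insert hi]
    exact hA.mul_mem_degreeLE (h i) ih

theorem IsLSAlgebra.exists_mem_degreeLE (hA : IsLSAlgebra K b x) (a : A) :
    ∃ r, a ∈ degreeLE K x r := by
  have ha : a ∈ pathSpan K x Set.univ := hA.pathSpan_univ ▸ Submodule.mem_top
  refine Submodule.span_induction ?_ ⟨0, zero_mem _⟩ ?_ ?_ ha
  · rintro _ ⟨π, -, rfl⟩
    exact ⟨π.degree, pathElem_mem_pathSpan (le_refl π.degree)⟩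
  · rintro a c _ _ ⟨r, hr⟩ ⟨s, hs⟩
    exact ⟨max r s, add_mem (degreeLE_mono (le_max_left _ _) hr)
      (degreeLE_mono (le_max_right _ _) hs)⟩
  · rintro k a _ ⟨r, hr⟩
    exact ⟨r, Submodule.smul_mem _ _ hr⟩

/-- The number of linearly independent elements of degree at most `r` is bounded by a polynomial
in `r` whose degree is the length of the poset. -/
theorem card_le_of_linearIndependent {n r : ℕ} {gr : S → Fin n} (hgr : StrictMono gr)
    {ι : Type*} [Fintype ι] (f : ι → A) (hf : LinearIndependent K f)
    (hr : ∀ i, f i ∈ degreeLE K x r) :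
    Fintype.card ι ≤ 2 ^ Fintype.card S * (bondDenominator b * r + 1) ^ n := by
  classical
  let T := {π : LSPath b // π.degree ≤ r}
  have hinj : Function.Injective (pathCode (b := b) (r := r) gr) := pathCode_injective hgr
  have : Finite T := Finite.of_injective _ hinj
  have := Fintype.ofFinite T
  have hrange : degreeLE K x r = Submodule.span K (Set.range fun π : T => pathElem x π.1) := by
    rw [degreeLE, pathSpan, Set.image_eq_range]
    rfl
  have hfin : Module.Finite K (degreeLE K x r) := by
    rw [hrange]
    exact Module.Finite.span_of_finite K (Set.finite_range _)
  have hli : LinearIndependent K fun i => (⟨f i, hr i⟩ : degreeLE K x r) :=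
    LinearIndependent.of_comp (degreeLE K x r).subtype hf
  calc Fintype.card ι ≤ Module.finrank K (degreeLE K x r) := hli.fintype_card_le_finrank
    _ ≤ Fintype.card T := by
      rw [hrange]
      exact finrank_range_le_card fun π : T => pathElem x π.1
    _ ≤ Fintype.card (Finset S × (Fin n → Fin (bondDenominator b * r + 1))) :=
      Fintype.card_le_of_injective _ hinj
    _ = _ := by simp

/-- More elements than the length of the poset have two monomials with the same value. -/
theorem IsLSAlgebra.exists_monomials [IsDomain A] (hA : IsLSAlgebra K b x) {n : ℕ}
    {gr : S → Fin n} (hgr : StrictMono gr) {V : Type*} [AddCommGroup V] [LinearOrder V]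
    [IsOrderedAddMonoid V] {w : A → V} (hw : IsValuation K w) {ι : Type*} [Fintype ι]
    (hn : n < Fintype.card ι) (f : ι → A) (hf : ∀ i, f i ≠ 0) :
    ∃ e e' : ι → ℕ, e ≠ e' ∧ ∑ i, e i • w (f i) = ∑ i, e' i • w (f i) := by
  classical
  by_contra! hcon
  choose d hd using fun i => hA.exists_mem_degreeLE (f i)
  set B : ℕ := 2 ^ Fintype.card S * (bondDenominator b * ∑ i, d i + 1) ^ n with hB
  -- With exponents below `k` there are at least `k ^ (n + 1)` monomials, in a space of dimension at
  -- most `B * k ^ n`. Independence would force `k ≤ B`.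
  obtain ⟨k, hkB⟩ : ∃ k, k = B + 1 := ⟨_, rfl⟩
  let m : (ι → Fin k) → A := fun e => ∏ i, f i ^ (e i : ℕ)
  have hm0 : ∀ e, m e ≠ 0 := fun e => Finset.prod_ne_zero_iff.2 fun i _ => pow_ne_zero _ (hf i)
  have hwm : ∀ e, w (m e) = ∑ i, (e i : ℕ) • w (f i) := fun e => by
    rw [hw.map_prod _ _ fun i => pow_ne_zero _ (hf i)]
    exact Finset.sum_congr rfl fun i _ => hw.map_pow (hf i) _
  have hli : LinearIndependent K m := by
    refine hw.linearIndependent m hm0 fun e e' h => ?_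
    simp only [hwm] at h
    by_contra hne
    exact hcon (fun i => e i) (fun i => e' i)
      (fun h' => hne (funext fun i => Fin.ext (congrFun h' i))) h
  have hdeg : ∀ e, m e ∈ degreeLE K x (k * ∑ i, d i) := by
    intro e
    refine degreeLE_mono ?_ (hA.prod_mem_degreeLE Finset.univ _ (fun i => (e i : ℕ) * d i)
      fun i => hA.pow_mem_degreeLE (hd i) (e i))
    rw [Finset.mul_sum]
    exact Finset.sum_le_sum fun i _ => Nat.mul_le_mul_right _ (e i).2.le
  have hcard := card_le_of_linearIndependent hgr m hli hdeg
  have hk : 1 ≤ k := by omega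
  have h1 : k ^ (n + 1) ≤ B * k ^ n := by
    calc k ^ (n + 1) ≤ k ^ Fintype.card ι := Nat.pow_le_pow_right hk hn
      _ = Fintype.card (ι → Fin k) := by simp
      _ ≤ 2 ^ Fintype.card S * (bondDenominator b * (k * ∑ i, d i) + 1) ^ n := hcard
      -- The summand `1` is absorbed because `1 ≤ k`.
      _ ≤ 2 ^ Fintype.card S * ((bondDenominator b * ∑ i, d i + 1) * k) ^ n := by
        gcongr
        rw [add_mul, one_mul, mul_left_comm, mul_comm k]
        gcongr
      _ = B * k ^ n := by rw [mul_pow, hB, mul_assoc]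
  rw [pow_succ, mul_comm] at h1
  have h2 := Nat.le_of_mul_le_mul_right h1 (pow_pos hk n)
  omega

end Growth

/-! ### The valuation attached to a flag -/

section FlagType

variable {S : Type*} [PartialOrder S] [Fintype S] {b : Bonds S} {K : Type*} {A : Type u} [Field K]
  [CommRing A] [Algebra K A] {x : LSPathOne b → A}

theorem IsFlagType.isPrime_pathIdeal (hA : IsFlagType K b x) (τ : S) : (pathIdeal x τ).IsPrime :=
  (Ideal.Quotient.isDomain_iff_prime _).1 (hA.isDomain τ)

theorem IsFlagType.isDomain_self [OrderTop S] (hA : IsFlagType K b x) : IsDomain A := by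
  have hbot : (⊥ : Ideal A).IsPrime := pathIdeal_top x ▸ hA.isPrime_pathIdeal ⊤
  have : Nontrivial A := ⟨0, 1, fun h => hbot.ne_top ((Ideal.eq_top_iff_one _).2 h.symm)⟩
  have : NoZeroDivisors A := ⟨fun {a c} h => hbot.mem_or_mem (I := ⊥) h⟩
  exact NoZeroDivisors.to_isDomain A

theorem IsLSAlgebra.extremal_ne_zero (hA : IsLSAlgebra K b x) (σ : S) :
    x (extremalOne b σ) ≠ 0 := fun h =>
  hA.extremal_notMem_pathIdeal σ (h ▸ Ideal.zero_mem _)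

/-- A valuation on an LS algebra of flag type for which each element of a flag has a value
infinitely larger than the previous ones. -/
theorem IsFlagType.exists_isValuation [IsDomain A] (hA : IsFlagType K b x) (C : Flag S)
    [Nonempty C] :
    ∃ (G : Type u) (_ : AddCommGroup G) (_ : LinearOrder G) (_ : IsOrderedAddMonoid G) (w : A → G),
      IsValuation K w ∧ (∀ a ∈ irrelevantIdeal x, a ≠ 0 → 0 < w a) ∧
      (∀ σ : C, 0 < w (x (extremalOne b (σ : S)))) ∧
      ∀ σ τ : C, σ < τ → ∀ m : ℕ,
        m • w (x (extremalOne b (σ : S))) < w (x (extremalOne b (τ : S))) := by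
  classical
  have hLS := hA.isLSAlgebra
  have : Nonempty S := (inferInstance : Nonempty C).map Subtype.val
  obtain ⟨P, hP, hPle⟩ := Ideal.exists_le_maximal _ hLS.irrelevantIdeal_ne_top
  have : Fintype C := Fintype.ofFinite C
  -- Path ideals reverse the order, so the flag is listed downwards; the maximal ideal `P` contains
  -- them all and comes last.
  let l : List (Ideal A) :=
    ((Finset.univ : Finset C).sort (· ≥ ·)).map (fun σ : C => pathIdeal x (σ : S)) ++ [P]
  have hmem : ∀ σ : C, pathIdeal x (σ : S) ∈ l := fun σ =>
    List.mem_append_left _ (List.mem_map.2 ⟨σ, by simp, rfl⟩)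
  have hPmem : P ∈ l := by simp [l]
  have hl : l.Pairwise (· ≤ ·) := by
    rw [List.pairwise_append, List.pairwise_map]
    refine ⟨((Finset.univ : Finset C).pairwise_sort (· ≥ ·)).imp fun h =>
      pathIdeal_anti x h, by simp, fun Q hQ Q' hQ' => ?_⟩
    obtain ⟨σ, -, rfl⟩ := List.mem_map.1 hQ
    rw [List.mem_singleton.1 hQ']
    exact (pathIdeal_le_irrelevantIdeal x _).trans hPle
  have hp : ∀ Q ∈ l, Q.IsPrime := by
    intro Q hQ
    rcases List.mem_append.1 hQ with hQ | hQ
    · obtain ⟨σ, -, rfl⟩ := List.mem_map.1 hQ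
      exact hA.isPrime_pathIdeal _
    · rw [List.mem_singleton.1 hQ]
      exact hP.isPrime
  obtain ⟨G, i₁, i₂, i₃, w, hw, hlt⟩ := exists_isValuation_of_chain (K := K) l hl hp
  -- Comparison with `1`, which lies outside `P`.
  have hirr : ∀ a ∈ irrelevantIdeal x, a ≠ 0 → 0 < w a := by
    intro a ha ha0
    rw [← hw.map_one]
    exact hlt P hPmem a (hPle ha) 1 ((Ideal.ne_top_iff_one _).1 hP.ne_top) ha0
  refine ⟨G, i₁, i₂, i₃, w, hw, hirr, fun σ => ?_, fun σ τ hστ m => ?_⟩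
  · refine hirr _ (Ideal.subset_span ⟨(extremalOne b (σ : S)).1, ?_, pathElem_coe x _⟩)
      (hLS.extremal_ne_zero _)
    exact (zero_lt_one : 0 < 1)
  -- The prime of `σ` separates: it contains the element `τ` but no power of the element `σ`.
  · rw [← hw.map_pow (hLS.extremal_ne_zero _)]
    refine hlt _ (hmem σ) _ (extremal_mem_pathIdeal x ?_) _ ?_ (hLS.extremal_ne_zero _)
    · exact not_le_of_gt hστ
    · exact fun h => hLS.extremal_notMem_pathIdeal _ ((hA.isPrime_pathIdeal _).mem_of_pow_mem _ h)

/-- The values of a valuation have rational coordinates with respect to the values of the elements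
of a flag, if each of these is infinitely larger than the previous ones. -/
theorem IsLSAlgebra.exists_hasCoordinates [IsDomain A] [BoundedOrder S] [GradeMinOrder ℕ S]
    (hA : IsLSAlgebra K b x) {C : Flag S} [Fintype C] {G : Type*} [AddCommGroup G] [LinearOrder G]
    [IsOrderedAddMonoid G] {w : A → G} (hw : IsValuation K w)
    (hpos : ∀ σ : C, 0 < w (x (extremalOne b (σ : S))))
    (hg : ∀ σ τ : C, σ < τ → ∀ m : ℕ,
      m • w (x (extremalOne b (σ : S))) < w (x (extremalOne b (τ : S)))) {a : A} (ha : a ≠ 0) :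
    ∃ q : ChainSpace C, HasCoordinates (fun σ : C => w (x (extremalOne b (σ : S)))) (w a) q := by
  obtain ⟨n, gr, hgr, hn⟩ := exists_strictMono_fin_flag C
  -- The family consists of `a` and the elements of `C`: one more than `|C|`, hence more than `n`.
  obtain ⟨e, e', hne, hee⟩ := hA.exists_monomials hgr hw (ι := Option C)
    (by rw [Fintype.card_option]; omega)
    (fun i => i.elim a fun σ => x (extremalOne b (σ : S)))
    (fun i => by cases i with
      | none => exact ha
      | some σ => exact hA.extremal_ne_zero _)
  rw [Fintype.sum_option, Fintype.sum_option] at hee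
  simp only [Option.elim_none, Option.elim_some] at hee
  have hrel : ((e none : ℤ) - e' none) • w a =
      ∑ σ : C, ((e' (some σ) : ℤ) - e (some σ)) • w (x (extremalOne b (σ : S))) := by
    simp_rw [sub_smul, Finset.sum_sub_distrib, natCast_zsmul]
    rw [sub_eq_sub_iff_add_eq_add, hee, add_comm]
  -- If `w a` dropped out, the remaining relation would be a coordinate vector of `0`, hence zero by
  -- uniqueness, and the two monomials would coincide.
  by_cases hk : (e none : ℤ) - e' none = 0
  · exfalso
    apply hne
    have hq : (toColex fun σ => ((e' (some σ) : ℤ) - e (some σ) : ℤ) : ChainSpace C) = 0 := by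
      refine HasCoordinates.unique (u := 0) hpos hg ?_ (hasCoordinates_zero _)
      exact ⟨1, fun σ => (e' (some σ) : ℤ) - e (some σ), one_pos,
        by rw [← hrel, hk, zero_smul, smul_zero], fun σ => by simp⟩
    funext i
    cases i with
    | none => omega
    | some σ =>
      have h1 : ((((e' (some σ) : ℤ) - e (some σ) : ℤ)) : ℚ) = 0 := congrFun hq σ
      have h2 : (e' (some σ) : ℤ) - e (some σ) = 0 := by exact_mod_cast h1
      omega
  · exact LSAlg.exists_hasCoordinates hk _ hrel

/-- The map `ν` takes coordinates of `w`: inequalities transfer by monotonicity of coordinates,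
identities by their uniqueness. -/
theorem IsFlagType.exists_positive_valuation [BoundedOrder S] [GradeMinOrder ℕ S]
    (hA : IsFlagType K b x) (C : Flag S) :
    ∃ ν : A → ChainSpace C, IsValuation K ν ∧ IsPositive (degreePart K x) ν ∧
      ∀ σ : C, ν (x (extremalOne b σ)) = chainVec σ := by
  have hLS := hA.isLSAlgebra
  have : IsDomain A := hA.isDomain_self
  have : Fintype C := Fintype.ofFinite C
  have : Nonempty C := ⟨⊥⟩
  obtain ⟨G, _, _, _, w, hw, hirr, hpos, hg⟩ := hA.exists_isValuation C
  choose! ν hν using fun (a : A) (ha : a ≠ 0) => hLS.exists_hasCoordinates hw hpos hg ha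
  refine ⟨ν, ⟨?_, ?_, ?_⟩, ?_, ?_⟩
  · intro a c ha hc hac
    rw [min_le_iff]
    refine (min_le_iff.1 (hw.min_le_add a c ha hc hac)).imp ?_ ?_
    · exact (hν a ha).mono hpos hg (hν _ hac)
    · exact (hν c hc).mono hpos hg (hν _ hac)
  · intro c a hc ha
    have hca : c • a ≠ 0 := fun h => ha ((IsUnit.mk0 c hc).smul_eq_zero.1 h)
    refine HasCoordinates.unique hpos hg (hν _ hca) ?_
    rw [hw.smul_eq c a hc ha]
    exact hν a ha
  · intro a c ha hc hac
    refine HasCoordinates.unique hpos hg (hν _ hac) ?_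
    rw [hw.mul_eq a c ha hc hac]
    exact (hν a ha).add (hν c hc)
  · rintro a ⟨r, hr⟩ ha hu
    have hr0 : r ≠ 0 := by
      rintro rfl
      exact hu (isUnit_of_mem_degreePart_zero hr ha)
    have h1 := hirr a (degreePart_le_irrelevantIdeal hr0 hr) ha
    -- Monotonicity gives only `0 ≤ ν a`; equality would force `w a = 0`.
    refine lt_of_le_of_ne ((hasCoordinates_zero _).mono hpos hg (hν a ha) h1.le) fun h2 => ?_
    exact h1.ne' (HasCoordinates.eq_zero (h2 ▸ hν a ha))
  · exact fun σ => HasCoordinates.unique hpos hg (hν _ (hLS.extremal_ne_zero _))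
      (hasCoordinates_chainVec _ σ)

end FlagType

end LSAlg

theorem mainTheorem2 {S : Type*} [PartialOrder S] [BoundedOrder S] [Fintype S] [GradeMinOrder ℕ S]
    {K A : Type*} [Field K] [CommRing A] [Algebra K A]
    (b : LSAlg.Bonds S) (x : LSAlg.LSPathOne b → A) (hA : LSAlg.IsFlagType K b x) (C : Flag S) :
    ∃ ν : A → LSAlg.ChainSpace C,
      LSAlg.IsValuation K ν ∧
      LSAlg.IsPositive (LSAlg.degreePart K x) ν ∧
      ∀ σ : C, ν (x (LSAlg.extremalOne b σ)) = LSAlg.chainVec σ :=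
  hA.exists_positive_valuation C
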